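/- All logarithms are to base 2. Let $\log^{(0)}x=x$ and $\log^{(r)}x=\log(\log^{(r-1)}x)$ for $r\ge 1$, and let $\log^*x$ be the smallest integer $r\ge 0$ with $\log^{(r)}x<2$. In the exists-equal problem $\mathrm{EE}_n$ ($n\ge 1$), Alice and Bob receive vectors $x,y\in[t]^n$, respectively, where $t=4n$; the value $\mathrm{EE}_n(x,y)$ is $1$ if $x_i=y_i$ for some $i\in[n]$, and $0$ otherwise. In an $r$-round randomized protocol the players share a common random source and take at most $r$ turns, alternately sending each other a message (a bit string determined by the sender's input, the common randomness and the messages so far); which player moves first is fixed, and when to stop is determined by the randomness and the messages so far. The last player to receive a message (the designated first player, if no message is sent) declares the output. The error probability is the maximum over inputs $(x,y)$ of the probability that the output differs from $\mathrm{EE}_n(x,y)$. Theorem. There is an absolute constant $c>0$ such that for all integers $n\ge 1$ and $0\le r\le\log^*n$, every $r$-round randomized protocol for $\mathrm{EE}_n$ with error probability at most $1/3$ sends at least one message of size at least $c\,n\log^{(r)}n$ bits; that is, on some input pair $(x,y)$, with positive probability, at least one of the messages sent has at least $c\,n\log^{(r)}n$ bits. -/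

import Mathlib

open MeasureTheory

/-- The iterated base-2 logarithm: `log^{(0)} x = x`, `log^{(r)} x = log (log^{(r-1)} x)`. -/
noncomputable def iterLog : ℕ → ℝ → ℝ
  | 0, x => x
  | r + 1, x => Real.logb 2 (iterLog r x)

/-- `log^* x` is the smallest `r` for which `log^{(r)} x < 2`. -/
noncomputable def logStar (x : ℝ) : ℕ :=
  sInf {r : ℕ | iterLog r x < 2}

/-- The value of the exists-equal game on vectors `x, y ∈ [t]^n`:
`true` iff some coordinate of `x` and `y` agrees. -/
def existsEqual (n t : ℕ) (x y : Fin n → Fin t) : Bool :=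
  decide (∃ i, x i = y i)

/-- The two players. -/
inductive Player
  | alice
  | bob

/-- A deterministic two-player protocol in which the players, both with inputs in `X`, take at most
`r` turns. One of the players, the active one, is to move; the other one is waiting. Either the
protocol is over and the active player declares the output, or the active player sends a message
(a bit string that depends on this player's input) and the roles are exchanged, so that the player
who declares the output is the last one to have received a message. How the protocol goes on after
a message may depend on that message. -/
inductive DetProtocol (X : Type*) : ℕ → Type _
  | output {r : ℕ} (f : X → Bool) : DetProtocol X r
  | send {r : ℕ} (msg : X → List Bool) (next : List Bool → DetProtocol X r) : DetProtocol X (r + 1)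

namespace DetProtocol

variable {X : Type*}

/-- The output of the protocol if the active player has input `a` and the waiting player has
input `b`. -/
def eval : {r : ℕ} → DetProtocol X r → X → X → Bool
  | _, output f, a, _ => f a
  | _, send msg next, a, b => (next (msg a)).eval b a

/-- The list of the messages sent if the active player has input `a` and the waiting player has
input `b`. -/
def messages : {r : ℕ} → DetProtocol X r → X → X → List (List Bool)
  | _, output _, _, _ => []
  | _, send msg next, a, b => msg a :: (next (msg a)).messages b a

end DetProtocol

/-- An `r`-round randomized protocol with inputs in `X` and a common random source with values
in `Ω`: one of the players is designated to move first, and every value of the random source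
determines a deterministic protocol with at most `r` turns. For fixed inputs the output is a random
variable. -/
structure RandProtocol (Ω : Type*) [MeasurableSpace Ω] (X : Type*) (r : ℕ) where
  first : Player
  det : Ω → DetProtocol X r
  measurable_eval : ∀ a b : X, Measurable fun ω => (det ω).eval a b

namespace RandProtocol

variable {Ω X : Type*} [MeasurableSpace Ω] {r : ℕ}

/-- The output for the random source value `ω` when Alice has input `x` and Bob has input `y`. -/
def eval (P : RandProtocol Ω X r) (ω : Ω) (x y : X) : Bool :=
  match P.first with
  | .alice => (P.det ω).eval x y
  | .bob => (P.det ω).eval y x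

/-- The messages sent for the random source value `ω` when Alice has input `x` and Bob has
input `y`. -/
def messages (P : RandProtocol Ω X r) (ω : Ω) (x y : X) : List (List Bool) :=
  match P.first with
  | .alice => (P.det ω).messages x y
  | .bob => (P.det ω).messages y x

/-- The error probability of the protocol `P` for the function `f`, when the random source is
distributed according to `μ`: the supremum over the inputs `(x, y)` of the probability that the
output differs from `f x y`. -/
noncomputable def error (P : RandProtocol Ω X r) (μ : Measure Ω) (f : X → X → Bool) : ENNReal :=
  ⨆ (x : X) (y : X), μ {ω | P.eval ω x y ≠ f x y}

/-- On some pair of inputs, with positive probability, the protocol sends a message of at least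
`L` bits. -/
def SendsMessageOfSize (P : RandProtocol Ω X r) (μ : Measure Ω) (L : ℝ) : Prop :=
  ∃ x y : X, 0 < μ {ω | ∃ m ∈ P.messages ω x y, L ≤ (m.length : ℝ)}

end RandProtocol

/-! The proof eliminates rounds one at a time. A protocol is judged by its `labelError`: the
probability of answering `true` on a uniformly random pair plus that of answering `false` on a
random pair with one planted equality. Each input alone is uniform under both laws, so an output
that depends on one input only has label error exactly 1.

To drop a first message, restrict the sender's input to the set `S` of inputs that send it. Group
the coordinates into `m` blocks of `8 ^ b`, and let each block be one letter of a new game. The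
sender, holding a uniform `u` of the new game, moves it into `S` by a deterministic map `ζ`. A
planted equality of the new game shares a whole block between `u` and the other input; after the
move it should look like one shared letter at a random place of that block. So the new protocol,
which skips the message, has nearly the label error of the old one (`exists_labelError_le`).

The map exists for the following reason. If `ν` on a block has small relative entropy, then planting
one letter of a sample of `ν` at a random coordinate of a uniform block gives a nearly uniform block
(`expect_max_one_sub_expect_marginalDensity_le`): the density is an average of `8 ^ b` independent
terms, which concentrates once rare large values are truncated. Hence a uniform block can be coupled
with a sample of `ν` (`exists_coupling`), and the coupling can be derandomized (`exists_transport`).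
Applying this block by block, with the chain rule for entropy, gives `exists_selection`. Averaged
over messages shorter than `C` bits, the entropy deficit is at most `C` bits, so a round costs `(C /
|ι| + 2) / b` (`le_labelError_of_forall_reduced`).

If all messages were short, the block sizes of `exists_blocks`, which grow like a tower, would keep
the total cost below 1/4. Error 1/3 on each side plus accidental equalities gives initial label
error at most 3/4, a contradiction. -/

open Finset Function
open scoped BigOperators

/-! ### Averages over finite product spaces -/

section ProductSpace

variable {ι α : Type*} [Fintype ι] [DecidableEq ι] [Fintype α]

/-- Exchanging a point of the product with a free letter at coordinate `i`. -/
def swapCoord (i : ι) : (ι → α) × α ≃ (ι → α) × α where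
  toFun p := (update p.1 i p.2, p.1 i)
  invFun p := (update p.1 i p.2, p.1 i)
  left_inv p := by simp
  right_inv p := by simp

/-- Resampling one coordinate preserves the uniform law; the bijection `swapCoord` keeps the
discarded letter. -/
theorem expect_expect_update (i : ι) (H : (ι → α) → ℝ) :
    𝔼 x, 𝔼 a, H (update x i a) = 𝔼 x, H x := by
  rcases isEmpty_or_nonempty α with hα | hα
  · have : IsEmpty (ι → α) := ⟨fun x => hα.false (x i)⟩
    simp
  have h1 := expect_product' (univ : Finset (ι → α)) (univ : Finset α)
    (fun x a => H (update x i a))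
  have h2 := expect_product' (univ : Finset (ι → α)) (univ : Finset α) (fun x _ => H x)
  rw [← h1]
  have h3 : 𝔼 x, H x = 𝔼 x : ι → α, 𝔼 _a : α, H x := by simp
  rw [h3, ← h2]
  refine Finset.expect_equiv (swapCoord i) (by simp) ?_
  simp [swapCoord]

/-- Exchanging the letters of two points of the product at coordinate `i`. -/
def swapAt (i : ι) : (ι → α) × (ι → α) ≃ (ι → α) × (ι → α) where
  toFun p := (update p.1 i (p.2 i), update p.2 i (p.1 i))
  invFun p := (update p.1 i (p.2 i), update p.2 i (p.1 i))
  left_inv p := by simp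
  right_inv p := by simp

/-- The law of a pair with a planted equality is symmetric in the two players. This allows their
roles to be exchanged after a dropped message. -/
theorem expect_expect_update_comm (i : ι) (H : (ι → α) → (ι → α) → ℝ) :
    𝔼 x, 𝔼 y, H x (update y i (x i)) = 𝔼 x, 𝔼 y, H (update x i (y i)) y := by
  have h1 := expect_product' (univ : Finset (ι → α)) (univ : Finset (ι → α))
    (fun x y => H x (update y i (x i)))
  have h2 := expect_product' (univ : Finset (ι → α)) (univ : Finset (ι → α))
    (fun x y => H (update x i (y i)) y)
  rw [← h1, ← h2]
  refine Finset.expect_equiv (swapAt i) (by simp) ?_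
  simp [swapAt]

theorem expect_coord (i : ι) (f : α → ℝ) [Nonempty α] :
    𝔼 x : ι → α, f (x i) = 𝔼 a, f a := by
  rw [← expect_expect_update i]
  simp

theorem expect_coord_mul_coord {i j : ι} (hij : i ≠ j) (f g : α → ℝ) [Nonempty α] :
    𝔼 x : ι → α, f (x i) * g (x j) = (𝔼 a, f a) * 𝔼 a, g a := by
  rw [← expect_expect_update i]
  simp [hij.symm, ← expect_mul, ← mul_expect, expect_coord]

theorem expect_prod_coord (f : ι → α → ℝ) :
    𝔼 x : ι → α, ∏ i, f i (x i) = ∏ i, 𝔼 a, f i a := by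
  simp only [Fintype.expect_eq_sum_div_card]
  rw [Finset.prod_div_distrib, Finset.prod_univ_sum]
  simp

/-- Conditioning coordinate `i` on the letter `a`, written as a reweighting. -/
theorem expect_update_eq [DecidableEq α] (i : ι) (a : α) (H : (ι → α) → ℝ) :
    𝔼 x, H (update x i a) = 𝔼 x, (if x i = a then (Fintype.card α : ℝ) else 0) * H x := by
  have : Nonempty α := ⟨a⟩
  rw [← expect_expect_update i (fun x => (if x i = a then (Fintype.card α : ℝ) else 0) * H x)]
  refine expect_congr rfl fun x _ => ?_
  rw [Fintype.expect_eq_sum_div_card]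
  simp

/-- The second moment of an average of independent centred variables. -/
theorem expect_sq_expect_coord_le [Nonempty ι] [Nonempty α] (f : ι → α → ℝ) (V : ℝ)
    (h0 : ∀ i, 𝔼 a, f i a = 0) (hV : ∀ i, 𝔼 a, f i a ^ 2 ≤ V) :
    𝔼 x : ι → α, (𝔼 i, f i (x i)) ^ 2 ≤ V / Fintype.card ι := by
  have h1 : ∀ x : ι → α, (𝔼 i, f i (x i)) ^ 2 = 𝔼 i, 𝔼 j, f i (x i) * f j (x j) := by
    intro x; rw [sq, Fintype.expect_mul_expect]
  simp only [h1]
  rw [expect_comm]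
  have h2 : ∀ i, 𝔼 x : ι → α, 𝔼 j, f i (x i) * f j (x j) ≤ V / Fintype.card ι := by
    intro i
    rw [expect_comm, Fintype.expect_eq_sum_div_card]
    have h3 : ∀ j, j ≠ i → 𝔼 x : ι → α, f i (x i) * f j (x j) = 0 := by
      intro j hj
      rw [expect_coord_mul_coord hj.symm, h0, zero_mul]
    rw [Finset.sum_eq_single i (fun j _ hj => h3 j hj) (by simp)]
    have h4 : 𝔼 x : ι → α, f i (x i) * f i (x i) = 𝔼 a, f i a ^ 2 := by
      simp only [← sq]
      exact expect_coord i (fun a => f i a ^ 2)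
    rw [h4]
    gcongr
    exact hV i
  exact expect_le univ_nonempty fun i _ => h2 i

theorem sq_expect_abs_le {β : Type*} [Fintype β] [Nonempty β] (g : β → ℝ) :
    (𝔼 x, |g x|) ^ 2 ≤ 𝔼 x, g x ^ 2 := by
  have := expect_mul_sq_le_sq_mul_sq univ (fun x => |g x|) (fun _ => (1 : ℝ))
  simpa using this

end ProductSpace

/-! ### Relative entropy and the Gibbs inequality -/

section RelativeEntropy

variable {β : Type*} [Fintype β]

/-- The relative entropy, in nats, of a weight function with respect to the uniform
distribution. -/
noncomputable def relEntropy (ν : β → ℝ) : ℝ :=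
  ∑ z, ν z * Real.log (ν z * Fintype.card β)

/-- The Gibbs variational inequality. -/
theorem sum_mul_le_relEntropy_add_log [Nonempty β] {ν : β → ℝ} (h0 : ∀ z, 0 ≤ ν z)
    (h1 : ∑ z, ν z = 1) (φ : β → ℝ) :
    ∑ z, ν z * φ z ≤ relEntropy ν + Real.log (𝔼 z, Real.exp (φ z)) := by
  set Z := 𝔼 z, Real.exp (φ z) with hZ
  have hZpos : 0 < Z := expect_pos (fun _ _ => Real.exp_pos _) univ_nonempty
  have hN : (0 : ℝ) < Fintype.card β := by exact_mod_cast Fintype.card_pos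
  have key : ∀ z, ν z * φ z - ν z * Real.log (ν z * Fintype.card β) - ν z * Real.log Z
      ≤ Real.exp (φ z) / (Fintype.card β * Z) - ν z := by
    intro z
    rcases (h0 z).eq_or_lt with h | h
    · rw [← h]; simp; positivity
    · have hpos : 0 < Real.exp (φ z) / (Fintype.card β * Z) / ν z := by positivity
      have := Real.log_le_sub_one_of_pos hpos
      rw [Real.log_div (by positivity) h.ne', Real.log_div (by positivity) (by positivity),
        Real.log_exp, Real.log_mul hN.ne' hZpos.ne'] at this
      rw [Real.log_mul h.ne' hN.ne']
      have h2 := mul_le_mul_of_nonneg_left this h.le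
      have h3 : ν z * (Real.exp (φ z) / (Fintype.card β * Z) / ν z - 1)
          = Real.exp (φ z) / (Fintype.card β * Z) - ν z := by field_simp
      rw [h3] at h2
      linarith
  have hs := Finset.sum_le_sum fun z (_ : z ∈ univ) => key z
  simp only [Finset.sum_sub_distrib, ← Finset.sum_mul, ← Finset.sum_div, h1] at hs
  have h4 : (∑ z, Real.exp (φ z)) / (Fintype.card β * Z) = 1 := by
    rw [hZ, Fintype.expect_eq_sum_div_card] at *
    field_simp at hZpos ⊢
  rw [h4] at hs
  unfold relEntropy
  linarith

end RelativeEntropy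

/-! ### Planting a letter from a distribution of small relative entropy -/

section Mixture

variable {σ α : Type*} [Fintype σ] [DecidableEq σ] [Fintype α]

/-- The marginals of a distribution of small relative entropy rarely hit small sets. -/
theorem sum_weight_mem_mul_log_le [Nonempty α] {ν : (σ → α) → ℝ} (h0 : ∀ z, 0 ≤ ν z)
    (h1 : ∑ z, ν z = 1) (T : σ → α → Prop) [∀ i, DecidablePred (T i)] {M : ℝ} (hM : 1 ≤ M)
    (hT : ∀ i, 𝔼 a, (if T i a then M else 0) ≤ 1) :
    (∑ i, ∑ z, ν z * (if T i (z i) then 1 else 0)) * Real.log M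
      ≤ relEntropy ν + Fintype.card σ * Real.log 2 := by
  -- The test function is `log M` times the number of hits. Its exponential factorizes over the
  -- coordinates, and each factor is at most `1 + M * 1_T`, of mean at most 2.
  have hg := sum_mul_le_relEntropy_add_log h0 h1
    (fun z => ∑ i, if T i (z i) then Real.log M else 0)
  have e1 : ∑ z, ν z * ∑ i, (if T i (z i) then Real.log M else 0)
      = (∑ i, ∑ z, ν z * (if T i (z i) then 1 else 0)) * Real.log M := by
    simp only [Finset.mul_sum, Finset.sum_mul]
    rw [Finset.sum_comm]
    refine Finset.sum_congr rfl fun i _ => Finset.sum_congr rfl fun z _ => ?_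
    split_ifs <;> simp
  rw [e1] at hg
  refine hg.trans (add_le_add_right ?_ _)
  simp only [Real.exp_sum]
  rw [expect_prod_coord (fun i a => Real.exp (if T i a then Real.log M else 0))]
  have hb : ∀ i, 𝔼 a, Real.exp (if T i a then Real.log M else 0) ≤ 2 := by
    intro i
    have : ∀ a, Real.exp (if T i a then Real.log M else 0) ≤ 1 + if T i a then M else 0 := by
      intro a
      split_ifs
      · rw [Real.exp_log (by linarith)]; linarith
      · simp
    refine (expect_le_expect fun a _ => this a).trans ?_
    rw [expect_add_distrib, Fintype.expect_one]
    linarith [hT i]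
  have hpos : ∀ i, 0 < 𝔼 a, Real.exp (if T i a then Real.log M else 0) := fun i =>
    expect_pos (fun _ _ => Real.exp_pos _) univ_nonempty
  rw [Real.log_prod (fun i _ => (hpos i).ne')]
  refine (Finset.sum_le_sum fun i _ => Real.log_le_log (hpos i) (hb i)).trans ?_
  simp

variable [DecidableEq α]

/-- The density, with respect to the uniform distribution, of the `i`-th marginal of a weight
function on a product. -/
noncomputable def marginalDensity (ν : (σ → α) → ℝ) (i : σ) (a : α) : ℝ :=
  Fintype.card α * ∑ z, if z i = a then ν z else 0

theorem marginalDensity_nonneg {ν : (σ → α) → ℝ} (h0 : ∀ z, 0 ≤ ν z) (i : σ) (a : α) :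
    0 ≤ marginalDensity ν i a :=
  mul_nonneg (Nat.cast_nonneg _) (Finset.sum_nonneg fun z _ => by split_ifs <;> simp [h0])

theorem expect_marginalDensity_mul [Nonempty α] (ν : (σ → α) → ℝ) (i : σ) (f : α → ℝ) :
    𝔼 a, marginalDensity ν i a * f a = ∑ z, ν z * f (z i) := by
  have hN : (Fintype.card α : ℝ) ≠ 0 := by exact_mod_cast Fintype.card_ne_zero
  simp only [Fintype.expect_eq_sum_div_card, marginalDensity, mul_assoc, ← Finset.mul_sum]
  rw [mul_div_cancel_left₀ _ hN]
  simp only [Finset.sum_mul]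
  rw [Finset.sum_comm]
  simp

/-- Planting one letter of a sample of `ν` at a random coordinate of a uniformly random point
gives a nearly uniform point, if there are enough coordinates compared to the entropy deficit. -/
theorem expect_max_one_sub_expect_marginalDensity_le [Nonempty α] {b : ℕ} (hb : 0 < b)
    (hσ : Fintype.card σ = 8 ^ b) {ν : (σ → α) → ℝ} (h0 : ∀ z, 0 ≤ ν z) (h1 : ∑ z, ν z = 1) :
    𝔼 x : σ → α, max (1 - 𝔼 i, marginalDensity ν i (x i)) 0
      ≤ 2 / b + 1 / (8 ^ b * (b * Real.log 2)) * relEntropy ν := by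
  have : Nonempty σ := Fintype.card_pos_iff.mp (by rw [hσ]; positivity)
  -- The truncation level balances two errors: `log M` is proportional to `b`, so little mass lies
  -- above `M`, while the averaged truncated densities have variance at most `M / 8 ^ b = 4 ^ (-b)`.
  set M : ℝ := 2 ^ b with hMdef
  have hM1 : 1 ≤ M := one_le_pow₀ (by norm_num)
  set T : σ → α → Prop := fun i a => M < marginalDensity ν i a with hTdef
  have hdec : ∀ i, DecidablePred (T i) := fun i => Classical.decPred _
  have hone : ∀ i, 𝔼 a, marginalDensity ν i a = 1 := by
    intro i
    have := expect_marginalDensity_mul ν i (fun _ => 1)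
    simpa [h1] using this
  have hTle : ∀ i, 𝔼 a, (if T i a then M else 0) ≤ 1 := by
    intro i
    rw [← hone i]
    refine expect_le_expect fun a _ => ?_
    split_ifs with h
    · exact h.le
    · exact marginalDensity_nonneg h0 i a
  set mass : σ → ℝ := fun i => ∑ z, ν z * (if T i (z i) then 1 else 0) with hmass
  have hmassle := sum_weight_mem_mul_log_le h0 h1 T hM1 hTle
  set h : σ → α → ℝ := fun i a => if T i a then 0 else marginalDensity ν i a with hh
  have hmean : ∀ i, 𝔼 a, h i a = 1 - mass i := by
    intro i
    have e := expect_marginalDensity_mul ν i (fun a => if T i a then 1 else 0)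
    have e' : 1 - mass i = 𝔼 a, (marginalDensity ν i a
        - marginalDensity ν i a * if T i a then 1 else 0) := by
      rw [expect_sub_distrib, hone, e]
    rw [e']
    refine expect_congr rfl fun a _ => ?_
    simp only [hh]
    split_ifs <;> simp
  have hnn : ∀ i a, 0 ≤ h i a := by
    intro i a
    simp only [hh]
    split_ifs
    · exact le_rfl
    · exact marginalDensity_nonneg h0 i a
  have hle : ∀ i a, h i a ≤ marginalDensity ν i a := by
    intro i a
    simp only [hh]
    split_ifs
    · exact marginalDensity_nonneg h0 i a
    · exact le_rfl
  have hleM : ∀ i a, h i a ≤ M := by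
    intro i a
    simp only [hh]
    split_ifs with hc
    · linarith
    · exact not_lt.mp hc
  have hvar : ∀ i, 𝔼 a, (h i a - (1 - mass i)) ^ 2 ≤ M := by
    intro i
    have e : 𝔼 a, (h i a - (1 - mass i)) ^ 2 = 𝔼 a, h i a ^ 2 - (1 - mass i) ^ 2 := by
      have : ∀ a, (h i a - (1 - mass i)) ^ 2
          = h i a ^ 2 - (2 * (1 - mass i)) * h i a + (1 - mass i) ^ 2 := fun a => by ring
      simp only [this]
      rw [expect_add_distrib, expect_sub_distrib, ← mul_expect, hmean, Fintype.expect_const]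
      ring
    have e2 : 𝔼 a, h i a ^ 2 ≤ M := by
      calc 𝔼 a, h i a ^ 2 ≤ 𝔼 a, M * marginalDensity ν i a := by
            refine expect_le_expect fun a _ => ?_
            rw [sq]
            exact mul_le_mul (hleM i a) (hle i a) (hnn i a) (by linarith)
        _ = M := by rw [← mul_expect, hone, mul_one]
    rw [e]
    linarith [sq_nonneg (1 - mass i)]
  have hcent : ∀ i, 𝔼 a, (h i a - (1 - mass i)) = 0 := by
    intro i
    rw [expect_sub_distrib, hmean, Fintype.expect_const, sub_self]
  have hsec := expect_sq_expect_coord_le (fun i a => h i a - (1 - mass i)) M hcent hvar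
  have hdev : 𝔼 x : σ → α, |𝔼 i, (h i (x i) - (1 - mass i))| ≤ 1 / b := by
    have h2 := (sq_expect_abs_le fun x : σ → α => 𝔼 i, (h i (x i) - (1 - mass i))).trans hsec
    have h3 : M / Fintype.card σ = (1 / 2 ^ b) ^ 2 := by
      rw [hσ, hMdef]
      push_cast
      rw [show (8 : ℝ) = 2 * 2 * 2 by norm_num, mul_pow, mul_pow]
      field_simp
    rw [h3] at h2
    refine (abs_le_of_sq_le_sq' h2 (by positivity)).2.trans ?_
    have : (b : ℝ) ≤ 2 ^ b := by exact_mod_cast Nat.lt_two_pow_self.le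
    gcongr
  have hpt : ∀ x : σ → α, max (1 - 𝔼 i, marginalDensity ν i (x i)) 0
      ≤ |𝔼 i, (h i (x i) - (1 - mass i))| + 𝔼 i, mass i := by
    intro x
    have hm0 : 0 ≤ 𝔼 i, mass i := expect_nonneg fun i _ =>
      Finset.sum_nonneg fun z _ => mul_nonneg (h0 z) (by split_ifs <;> simp)
    refine max_le ?_ (by positivity)
    have e1 : 𝔼 i, h i (x i) ≤ 𝔼 i, marginalDensity ν i (x i) :=
      expect_le_expect fun i _ => hle i _
    have e2 : 𝔼 i, (h i (x i) - (1 - mass i)) = 𝔼 i, h i (x i) - (1 - 𝔼 i, mass i) := by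
      rw [expect_sub_distrib, expect_sub_distrib, Fintype.expect_one]
    have e3 := neg_abs_le (𝔼 i, (h i (x i) - (1 - mass i)))
    linarith
  have hlog2 : 0 < Real.log 2 := Real.log_pos (by norm_num)
  have hb' : (0 : ℝ) < b := by exact_mod_cast hb
  have hmassavg : 𝔼 i, mass i ≤ 1 / b + 1 / (8 ^ b * (b * Real.log 2)) * relEntropy ν := by
    rw [Fintype.expect_eq_sum_div_card, hσ]
    rw [hMdef, Real.log_pow, hσ] at hmassle
    push_cast at hmassle ⊢
    rw [div_le_iff₀ (by positivity)]
    refine le_of_mul_le_mul_right (hmassle.trans (le_of_eq ?_))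
      (show 0 < (b : ℝ) * Real.log 2 by positivity)
    field_simp
    ring
  calc _ ≤ 𝔼 x : σ → α, (|𝔼 i, (h i (x i) - (1 - mass i))| + 𝔼 i, mass i) :=
        expect_le_expect fun x _ => hpt x
    _ = 𝔼 x : σ → α, |𝔼 i, (h i (x i) - (1 - mass i))| + 𝔼 i, mass i := by
        rw [expect_add_distrib, Fintype.expect_const]
    _ ≤ _ := by
        have : (2 : ℝ) / b = 1 / b + 1 / b := by ring
        linarith

end Mixture

/-! ### Coupling and its derandomization -/

section Transport

variable {β : Type*} [Fintype β]

/-- A weight function on pairs with marginals uniform and `ν` which exceeds the pair law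
`ν z * Q z x` by at most the deficit of its second marginal from the uniform distribution. -/
theorem exists_coupling {ν : β → ℝ} (h0 : ∀ z, 0 ≤ ν z)
    (h1 : ∑ z, ν z = 1) {Q : β → β → ℝ} (hQ0 : ∀ z w, 0 ≤ Q z w) (hQ1 : ∀ z, ∑ w, Q z w = 1)
    {u : β → ℝ} (hu0 : ∀ x, 0 < u x) (hu1 : ∑ x, u x = 1) :
    ∃ R : β → β → ℝ, (∀ x z, 0 ≤ R x z) ∧ (∀ x, ∑ z, R x z = u x) ∧ (∀ z, ∑ x, R x z = ν z) ∧
      ∀ H : β → β → ℝ, (∀ z x, 0 ≤ H z x) → (∀ z x, H z x ≤ 1) →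
        ∑ x, ∑ z, R x z * H z x ≤
          ∑ z, ν z * ∑ w, Q z w * H z w + ∑ x, max (u x - ∑ z, ν z * Q z x) 0 := by
  -- A maximal coupling: `g` is the law of the second point under the pair law. A pair is kept with
  -- probability `κ x = min 1 (u x / g x)`; the rejected mass `ρ` is spread over the deficit of `g`
  -- from `u`, of total `τ`.
  set g : β → ℝ := fun x => ∑ z, ν z * Q z x with hg
  have hg0 : ∀ x, 0 ≤ g x := fun x => Finset.sum_nonneg fun z _ => mul_nonneg (h0 z) (hQ0 z x)
  set κ : β → ℝ := fun x => if g x ≤ u x then 1 else u x / g x with hκ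
  have hκ0 : ∀ x, 0 ≤ κ x := fun x => by
    simp only [hκ]; split_ifs
    · exact zero_le_one
    · exact div_nonneg (hu0 x).le (hg0 x)
  have hκ1 : ∀ x, κ x ≤ 1 := fun x => by
    simp only [hκ]; split_ifs with h
    · exact le_rfl
    · exact div_le_one_of_le₀ (not_le.mp h).le (hg0 x)
  have hgκ : ∀ x, g x * κ x = u x - max (u x - g x) 0 := fun x => by
    simp only [hκ]; split_ifs with h
    · rw [max_eq_left (by linarith)]; ring
    · have : 0 < g x := (hu0 x).trans (not_le.mp h)
      rw [max_eq_right (by linarith [not_le.mp h])]; field_simp; ring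
  set τ : ℝ := ∑ x, max (u x - g x) 0 with hτ
  have hm0 : ∀ x, 0 ≤ max (u x - g x) 0 := fun x => le_max_right _ _
  have hτ0 : 0 ≤ τ := Finset.sum_nonneg fun x _ => hm0 x
  have hgsum : ∑ x, g x = 1 := by
    simp only [hg]
    rw [Finset.sum_comm]
    simp [← Finset.mul_sum, hQ1, h1]
  set ρ : β → ℝ := fun z => ∑ x, ν z * Q z x * (1 - κ x) with hρ
  have hρ0 : ∀ z, 0 ≤ ρ z := fun z => Finset.sum_nonneg fun x _ =>
    mul_nonneg (mul_nonneg (h0 z) (hQ0 z x)) (by linarith [hκ1 x])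
  have hρsum : ∑ z, ρ z = τ := by
    simp only [hρ]
    rw [Finset.sum_comm]
    have : ∀ x, ∑ z, ν z * Q z x * (1 - κ x) = g x - u x + max (u x - g x) 0 := by
      intro x
      rw [← Finset.sum_mul, mul_sub, mul_one]
      change g x - g x * κ x = _
      rw [hgκ]; ring
    simp only [this, Finset.sum_add_distrib, Finset.sum_sub_distrib, hgsum, hu1, hτ]
    ring
  refine ⟨fun x z => ν z * Q z x * κ x + max (u x - g x) 0 * (ρ z / τ), ?_, ?_, ?_, ?_⟩
  · intro x z
    have := hQ0 z x; have := h0 z; have := hκ0 x; have := hm0 x; have := hρ0 z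
    positivity
  · intro x
    rw [Finset.sum_add_distrib, ← Finset.sum_mul, ← Finset.mul_sum, ← Finset.sum_div, hρsum]
    change g x * κ x + _ = _
    rw [hgκ]
    rcases eq_or_ne τ 0 with h | h
    · have : max (u x - g x) 0 = 0 :=
        (Finset.sum_eq_zero_iff_of_nonneg fun x _ => hm0 x).mp (hτ ▸ h) x (mem_univ x)
      simp [this]
    · rw [div_self h]; ring
  · intro z
    rw [Finset.sum_add_distrib, ← Finset.sum_mul]
    have e : τ * (ρ z / τ) = ρ z := by
      rcases eq_or_ne τ 0 with h | h
      · have : ρ z = 0 :=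
          (Finset.sum_eq_zero_iff_of_nonneg fun x _ => hρ0 x).mp (hρsum.trans h) z (mem_univ z)
        simp [this]
      · field_simp
    rw [← hτ, e]
    simp only [hρ]
    rw [← Finset.sum_add_distrib]
    have : ∀ x, ν z * Q z x * κ x + ν z * Q z x * (1 - κ x) = ν z * Q z x := fun x => by ring
    simp only [this, ← Finset.mul_sum, hQ1, mul_one]
  · intro H H0 H1
    have e : ∑ z, ν z * ∑ w, Q z w * H z w = ∑ x, ∑ z, ν z * Q z x * H z x := by
      rw [Finset.sum_comm]
      simp only [Finset.mul_sum, mul_assoc]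
    rw [e, hτ, ← Finset.sum_add_distrib]
    refine Finset.sum_le_sum fun x _ => ?_
    have e1 : ∀ z, (ν z * Q z x * κ x + max (u x - g x) 0 * (ρ z / τ)) * H z x
        ≤ ν z * Q z x * H z x + max (u x - g x) 0 * (ρ z / τ) := by
      intro z
      rw [add_mul]
      have hq := mul_nonneg (h0 z) (hQ0 z x)
      refine add_le_add ?_ ?_
      · exact mul_le_mul_of_nonneg_right (mul_le_of_le_one_right hq (hκ1 x)) (H0 z x)
      · exact mul_le_of_le_one_right
          (mul_nonneg (hm0 x) (div_nonneg (hρ0 z) hτ0)) (H1 z x)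
    refine (Finset.sum_le_sum fun z _ => e1 z).trans ?_
    rw [Finset.sum_add_distrib, ← Finset.mul_sum, ← Finset.sum_div, hρsum]
    gcongr
    exact mul_le_of_le_one_right (hm0 x) (div_self_le_one τ)

theorem exists_pos_and_mul_le_sum {R Φ : β → ℝ} (hR : ∀ z, 0 ≤ R z) (hs : 0 < ∑ z, R z) :
    ∃ z, 0 < R z ∧ (∑ z, R z) * Φ z ≤ ∑ z, R z * Φ z := by
  classical
  by_contra! hcon
  obtain ⟨z₀, -, hz₀⟩ := Finset.exists_lt_of_sum_lt (s := univ) (f := fun _ : β => (0 : ℝ))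
    (g := R) (by simpa using hs)
  have : ∑ z, R z * (∑ z, R z * Φ z) < ∑ z, R z * ((∑ z, R z) * Φ z) := by
    refine Finset.sum_lt_sum (fun z _ => ?_) ⟨z₀, mem_univ _, ?_⟩
    · rcases (hR z).eq_or_lt with h | h
      · simp [← h]
      · exact mul_le_mul_of_nonneg_left (hcon z h).le h.le
    · exact mul_lt_mul_of_pos_left (hcon z₀ hz₀) hz₀
  rw [← Finset.sum_mul] at this
  have e : ∑ z, R z * ((∑ z, R z) * Φ z) = (∑ z, R z) * ∑ z, R z * Φ z := by
    rw [Finset.mul_sum]; exact Finset.sum_congr rfl fun z _ => by ring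
  linarith

/-- Moving a uniformly random point into the support of `ν`, at a cost comparable to that of the
pair law `ν z * Q z x`. -/
theorem exists_transport [Nonempty β] {ν : β → ℝ} (h0 : ∀ z, 0 ≤ ν z)
    (h1 : ∑ z, ν z = 1) {Q : β → β → ℝ} (hQ0 : ∀ z w, 0 ≤ Q z w) (hQ1 : ∀ z, ∑ w, Q z w = 1)
    (A : β → ℝ) {H : β → β → ℝ} (H0 : ∀ z x, 0 ≤ H z x) (H1 : ∀ z x, H z x ≤ 1) :
    ∃ φ : β → β, (∀ x, 0 < ν (φ x)) ∧
      𝔼 x, (A (φ x) + H (φ x) x) ≤ ∑ z, ν z * (A z + ∑ w, Q z w * H z w) +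
        ∑ x, max (1 / (Fintype.card β : ℝ) - ∑ z, ν z * Q z x) 0 := by
  have hN : (0 : ℝ) < Fintype.card β := by exact_mod_cast Fintype.card_pos
  obtain ⟨R, R0, Rrow, Rcol, RH⟩ := exists_coupling h0 h1 hQ0 hQ1
    (u := fun _ => 1 / (Fintype.card β : ℝ)) (fun _ => by positivity)
    (by simp [hN.ne'])
  -- For each `x` some `z` in the support of `R x` costs no more than average. Positivity matters:
  -- it keeps `φ x` in the support of `ν`.
  have hex : ∀ x, ∃ z, 0 < R x z ∧
      1 / (Fintype.card β : ℝ) * (A z + H z x) ≤ ∑ z, R x z * (A z + H z x) := by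
    intro x
    have := exists_pos_and_mul_le_sum (R := R x) (Φ := fun z => A z + H z x) (R0 x)
      (by rw [Rrow]; positivity)
    rwa [Rrow] at this
  choose φ hφ0 hφ using hex
  refine ⟨φ, fun x => ?_, ?_⟩
  · refine (hφ0 x).trans_le ?_
    rw [← Rcol]
    exact Finset.single_le_sum (f := fun y => R y (φ x)) (fun y _ => R0 y _) (mem_univ x)
  · rw [Fintype.expect_eq_sum_div_card, Finset.sum_div]
    have e1 : ∑ x, (A (φ x) + H (φ x) x) / (Fintype.card β : ℝ)
        ≤ ∑ x, ∑ z, R x z * (A z + H z x) :=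
      Finset.sum_le_sum fun x _ => by rw [div_eq_inv_mul, ← one_div]; exact hφ x
    have e2 : ∑ x, ∑ z, R x z * (A z + H z x) = ∑ z, ν z * A z + ∑ x, ∑ z, R x z * H z x := by
      simp only [mul_add, Finset.sum_add_distrib]
      congr 1
      rw [Finset.sum_comm]
      simp only [← Finset.sum_mul, Rcol]
    have e3 := RH H H0 H1
    simp only [mul_add, Finset.sum_add_distrib]
    linarith

end Transport

/-! ### Moving a uniform tuple into a set, letter by letter -/

section Selection

variable {β : Type*} [Fintype β]

theorem sum_fin_cons {m : ℕ} (f : (Fin (m + 1) → β) → ℝ) :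
    ∑ x, f x = ∑ a, ∑ t : Fin m → β, f (Fin.cons a t) := by
  rw [← Fintype.sum_prod_type' (f := fun a t => f (Fin.cons a t))]
  exact (Fintype.sum_equiv (Fin.consEquiv fun _ => β) _ _ fun x => rfl).symm

theorem expect_fin_cons {m : ℕ} (f : (Fin (m + 1) → β) → ℝ) :
    𝔼 x, f x = 𝔼 a, 𝔼 t : Fin m → β, f (Fin.cons a t) := by
  simp only [Fintype.expect_eq_sum_div_card]
  rw [sum_fin_cons, ← Finset.sum_div, div_div]
  simp [pow_succ]

variable [DecidableEq β]

/-- The fibre of a set of nonempty tuples over a first letter. -/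
def tailFiber {m : ℕ} (S : Finset (Fin (m + 1) → β)) (a : β) : Finset (Fin m → β) :=
  univ.filter fun t => (Fin.cons a t : Fin (m + 1) → β) ∈ S

theorem sum_sum_tailFiber {m : ℕ} (S : Finset (Fin (m + 1) → β)) (f : (Fin (m + 1) → β) → ℝ) :
    ∑ a, ∑ t ∈ tailFiber S a, f (Fin.cons a t) = ∑ x ∈ S, f x := by
  have h := sum_fin_cons fun x => if x ∈ S then f x else 0
  rw [← Finset.sum_filter] at h
  simp only [Finset.filter_mem_eq_inter, Finset.univ_inter] at h
  simp only [h, tailFiber, Finset.sum_filter]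

theorem sum_card_tailFiber {m : ℕ} (S : Finset (Fin (m + 1) → β)) :
    ∑ a, ((tailFiber S a).card : ℝ) = S.card := by
  have := sum_sum_tailFiber S fun _ => 1
  simpa using this

/-- A uniformly random tuple `x` can be moved into a given set `S` of tuples, so that the letters
of `x` look to the new tuple `z` as if drawn from `Q (z k)`. The cost is governed by the
entropy deficit of `S`. -/
theorem exists_selection [Nonempty β] {Q : β → β → ℝ} (hQ0 : ∀ z w, 0 ≤ Q z w)
    (hQ1 : ∀ z, ∑ w, Q z w = 1) {c₀ lam : ℝ}
    (hQ : ∀ ν : β → ℝ, (∀ z, 0 ≤ ν z) → ∑ z, ν z = 1 →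
      ∑ x, max (1 / (Fintype.card β : ℝ) - ∑ z, ν z * Q z x) 0 ≤ c₀ + lam * relEntropy ν)
    (m : ℕ) (S : Finset (Fin m → β)) (hS : S.Nonempty) (G : (Fin m → β) → ℝ)
    (F : Fin m → (Fin m → β) → β → ℝ) (F0 : ∀ k z w, 0 ≤ F k z w) (F1 : ∀ k z w, F k z w ≤ 1) :
    ∃ ζ : (Fin m → β) → Fin m → β, (∀ x, ζ x ∈ S) ∧
      𝔼 x, (G (ζ x) + ∑ k, F k (ζ x) (x k)) ≤
        𝔼 z ∈ S, (G z + ∑ k, ∑ w, Q (z k) w * F k z w) +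
          (m * c₀ + lam * Real.log ((Fintype.card β : ℝ) ^ m / S.card)) := by
  induction m with
  | zero =>
    obtain ⟨z, hz⟩ := hS
    have hSe : S = {z} := by
      ext y; rw [Finset.mem_singleton]
      exact ⟨fun _ => Subsingleton.elim _ _, fun h => h ▸ hz⟩
    refine ⟨fun _ => z, fun _ => hz, ?_⟩
    subst hSe
    simp
  | succ m ih =>
    have hN : (0 : ℝ) < Fintype.card β := by exact_mod_cast Fintype.card_pos
    have hSpos : (0 : ℝ) < S.card := by exact_mod_cast hS.card_pos
    -- The law of the first letter of a uniform element of `S`.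
    set ν : β → ℝ := fun a => (tailFiber S a).card / S.card with hν
    have hν0 : ∀ a, 0 ≤ ν a := fun a => by positivity
    have hν1 : ∑ a, ν a = 1 := by
      simp only [hν]
      rw [← Finset.sum_div, sum_card_tailFiber, div_self hSpos.ne']
    -- The map for the remaining letters also depends on `x₁`, because the first cost involves the
    -- whole new tuple. With `x₁` and `z₁` fixed, that cost joins `G`. Empty fibres get a junk value
    -- so that `choose` applies.
    have hex : ∀ x₁ z₁ : β, ∃ ζ : (Fin m → β) → Fin m → β, (tailFiber S z₁).Nonempty →
        (∀ x, ζ x ∈ tailFiber S z₁) ∧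
        𝔼 x, ((G (Fin.cons z₁ (ζ x)) + F 0 (Fin.cons z₁ (ζ x)) x₁)
            + ∑ k : Fin m, F k.succ (Fin.cons z₁ (ζ x)) (x k)) ≤
          𝔼 t ∈ tailFiber S z₁, ((G (Fin.cons z₁ t) + F 0 (Fin.cons z₁ t) x₁)
            + ∑ k : Fin m, ∑ w, Q (t k) w * F k.succ (Fin.cons z₁ t) w) +
          (m * c₀ + lam * Real.log ((Fintype.card β : ℝ) ^ m / (tailFiber S z₁).card)) := by
      intro x₁ z₁
      by_cases hne : (tailFiber S z₁).Nonempty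
      · obtain ⟨ζ, h⟩ := ih (tailFiber S z₁) hne
          (fun t => G (Fin.cons z₁ t) + F 0 (Fin.cons z₁ t) x₁)
          (fun k t w => F k.succ (Fin.cons z₁ t) w) (fun _ _ _ => F0 _ _ _) (fun _ _ _ => F1 _ _ _)
        exact ⟨ζ, fun _ => h⟩
      · exact ⟨id, fun h => absurd h hne⟩
    choose ζ hζ using hex
    set A : β → ℝ := fun z₁ => 𝔼 t ∈ tailFiber S z₁, (G (Fin.cons z₁ t)
        + ∑ k : Fin m, ∑ w, Q (t k) w * F k.succ (Fin.cons z₁ t) w) +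
        (m * c₀ + lam * Real.log ((Fintype.card β : ℝ) ^ m / (tailFiber S z₁).card)) with hA
    set H : β → β → ℝ := fun z₁ x₁ => 𝔼 t ∈ tailFiber S z₁, F 0 (Fin.cons z₁ t) x₁ with hH
    have H0 : ∀ z x, 0 ≤ H z x := fun z x => expect_nonneg fun t _ => F0 _ _ _
    have H1 : ∀ z x, H z x ≤ 1 := fun z x => by
      rcases (tailFiber S z).eq_empty_or_nonempty with h | h
      · simp [hH, h]
      · exact expect_le h fun t _ => F1 _ _ _
    obtain ⟨φ, hφ, hφle⟩ := exists_transport hν0 hν1 hQ0 hQ1 A H0 H1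
    have hne : ∀ x, (tailFiber S (φ x)).Nonempty := fun x => by
      by_contra hcon
      have := hφ x
      simp [hν, Finset.not_nonempty_iff_eq_empty.mp hcon] at this
    refine ⟨fun x => Fin.cons (φ (x 0)) (ζ (x 0) (φ (x 0)) (Fin.tail x)), fun x => ?_, ?_⟩
    · have := (hζ (x 0) (φ (x 0)) (hne _)).1 (Fin.tail x)
      simpa [tailFiber] using this
    · rw [expect_fin_cons]
      have e1 : ∀ x₁, 𝔼 t : Fin m → β, (G (Fin.cons (φ x₁) (ζ x₁ (φ x₁) t))
          + ∑ k : Fin (m + 1), F k (Fin.cons (φ x₁) (ζ x₁ (φ x₁) t))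
            ((Fin.cons x₁ t : Fin (m + 1) → β) k)) ≤ A (φ x₁) + H (φ x₁) x₁ := by
        intro x₁
        have := (hζ x₁ (φ x₁) (hne _)).2
        simp only [Fin.sum_univ_succ, Fin.cons_zero, Fin.cons_succ]
        simp only [← add_assoc]
        refine this.trans (le_of_eq ?_)
        simp only [hA, hH, expect_add_distrib]
        ring
      have e2 : 𝔼 x₁, 𝔼 t : Fin m → β, (G (Fin.cons (φ x₁) (ζ x₁ (φ x₁) t))
          + ∑ k : Fin (m + 1), F k (Fin.cons (φ x₁) (ζ x₁ (φ x₁) t))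
            ((Fin.cons x₁ t : Fin (m + 1) → β) k)) ≤ 𝔼 x₁, (A (φ x₁) + H (φ x₁) x₁) :=
        expect_le_expect fun x₁ _ => e1 x₁
      simp only [Fin.cons_zero, Fin.tail_cons]
      refine e2.trans (hφle.trans ?_)
      have e3 := hQ ν hν0 hν1
      -- The chain rule: the deficit of `S` is that of its first letter plus the average deficit of
      -- its fibres.
      have e4 : ∑ z, ν z * Real.log ((Fintype.card β : ℝ) ^ m / (tailFiber S z).card)
          + relEntropy ν = Real.log ((Fintype.card β : ℝ) ^ (m + 1) / S.card) := by
        rw [relEntropy, ← Finset.sum_add_distrib, ← one_mul (Real.log (_ / (S.card : ℝ))), ← hν1,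
          Finset.sum_mul]
        refine Finset.sum_congr rfl fun z _ => ?_
        rcases (tailFiber S z).eq_empty_or_nonempty with h | h
        · simp [hν, h]
        · have hp : (0 : ℝ) < (tailFiber S z).card := by exact_mod_cast h.card_pos
          rw [← mul_add, ← Real.log_mul (by positivity) (by simp only [hν]; positivity)]
          congr 2
          simp only [hν]
          field_simp
          rw [pow_succ]
      have e5 : 𝔼 z ∈ S, (G z + ∑ k, ∑ w, Q (z k) w * F k z w)
          = ∑ z, ν z * (𝔼 t ∈ tailFiber S z, (G (Fin.cons z t)
            + ∑ k : Fin m, ∑ w, Q (t k) w * F k.succ (Fin.cons z t) w)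
            + ∑ w, Q z w * H z w) := by
        rw [Finset.expect_eq_sum_div_card, ← sum_sum_tailFiber, Finset.sum_div]
        refine Finset.sum_congr rfl fun z _ => ?_
        have e6 : ∑ w, Q z w * H z w
            = 𝔼 t ∈ tailFiber S z, ∑ w, Q z w * F 0 (Fin.cons z t) w := by
          simp only [hH, mul_expect]
          rw [Finset.expect_sum_comm]
        rw [e6, ← expect_add_distrib, Finset.expect_eq_sum_div_card]
        rcases (tailFiber S z).eq_empty_or_nonempty with h | h
        · simp [h]
        · have hp : (0 : ℝ) < (tailFiber S z).card := by exact_mod_cast h.card_pos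
          simp only [hν, Fin.sum_univ_succ, Fin.cons_zero, Fin.cons_succ]
          field_simp
          refine Finset.sum_congr rfl fun t _ => ?_
          ring
      rw [e5, ← e4]
      have e7 : ∀ z, ν z * (A z + ∑ w, Q z w * H z w)
          = ν z * (𝔼 t ∈ tailFiber S z, (G (Fin.cons z t)
            + ∑ k : Fin m, ∑ w, Q (t k) w * F k.succ (Fin.cons z t) w)
            + ∑ w, Q z w * H z w) + (ν z * (m * c₀)
            + lam * (ν z * Real.log ((Fintype.card β : ℝ) ^ m / (tailFiber S z).card))) := by
        intro z; simp only [hA]; ring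
      simp only [e7]
      rw [Finset.sum_add_distrib, Finset.sum_add_distrib, ← Finset.sum_mul, hν1, ← Finset.mul_sum]
      push_cast
      linarith

end Selection

/-! ### The planting kernel -/

section PlantingKernel

variable {σ α : Type*} [Fintype σ] [DecidableEq σ] [Fintype α] [DecidableEq α]

/-- The law of a uniformly random point of `σ → α` into which one letter of `z`, at a uniformly
random coordinate, has been planted. -/
noncomputable def plantingKernel (z w : σ → α) : ℝ :=
  (𝔼 i, if w i = z i then (Fintype.card α : ℝ) else 0) / Fintype.card (σ → α)

theorem plantingKernel_nonneg (z w : σ → α) : 0 ≤ plantingKernel z w :=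
  div_nonneg (expect_nonneg fun i _ => by split_ifs <;> positivity) (Nat.cast_nonneg _)

theorem sum_plantingKernel_mul (z : σ → α) (f : (σ → α) → ℝ) :
    ∑ w, plantingKernel z w * f w = 𝔼 i, 𝔼 w, f (update w i (z i)) := by
  have : ∀ w, plantingKernel z w * f w
      = (𝔼 i, (if w i = z i then (Fintype.card α : ℝ) else 0) * f w) / Fintype.card (σ → α) := by
    intro w; rw [plantingKernel, ← expect_mul]; ring
  simp only [this]
  rw [← Finset.sum_div, ← Fintype.expect_eq_sum_div_card, expect_comm]
  exact expect_congr rfl fun i _ => (expect_update_eq i (z i) f).symm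

theorem sum_plantingKernel [Nonempty σ] (z : σ → α) : ∑ w, plantingKernel z w = 1 := by
  obtain ⟨i⟩ := ‹Nonempty σ›
  have : Nonempty α := ⟨z i⟩
  have : Nonempty σ := ⟨i⟩
  have h := sum_plantingKernel_mul z fun _ => 1
  simpa using h

/-- Relative to the uniform law, the mixture of the kernels under `ν` has density the average of the
marginal densities, so the bound of `expect_max_one_sub_expect_marginalDensity_le` applies. -/
theorem sum_max_plantingKernel_le [Nonempty α] {b : ℕ} (hb : 0 < b)
    (hσ : Fintype.card σ = 8 ^ b) {ν : (σ → α) → ℝ} (h0 : ∀ z, 0 ≤ ν z) (h1 : ∑ z, ν z = 1) :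
    ∑ x, max (1 / (Fintype.card (σ → α) : ℝ) - ∑ z, ν z * plantingKernel z x) 0
      ≤ 2 / b + 1 / (8 ^ b * (b * Real.log 2)) * relEntropy ν := by
  refine le_trans (le_of_eq ?_) (expect_max_one_sub_expect_marginalDensity_le hb hσ h0 h1)
  rw [Fintype.expect_eq_sum_div_card, Finset.sum_div]
  refine Finset.sum_congr rfl fun x _ => ?_
  have hN : (0 : ℝ) < Fintype.card (σ → α) := by exact_mod_cast Fintype.card_pos
  have e : ∑ z, ν z * plantingKernel z x
      = (𝔼 i, marginalDensity ν i (x i)) / Fintype.card (σ → α) := by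
    simp only [plantingKernel, ← mul_div_assoc, ← Finset.sum_div, marginalDensity, mul_expect]
    rw [← Finset.expect_sum_comm]
    congr 1
    refine expect_congr rfl fun i _ => ?_
    rw [Finset.mul_sum]
    refine Finset.sum_congr rfl fun z _ => ?_
    simp only [eq_comm (a := x i)]
    split_ifs <;> simp [mul_comm]
  rw [e, ← sub_div, ← max_div_div_right hN.le, zero_div]

end PlantingKernel

/-! ### Translating the inputs of a protocol -/

namespace DetProtocol

variable {X Y : Type*}

/-- The protocol in which the active and the waiting player first translate their inputs by `φ`
and `ψ`. -/
def comap : {r : ℕ} → DetProtocol X r → (Y → X) → (Y → X) → DetProtocol Y r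
  | _, output f, φ, _ => output fun a => f (φ a)
  | _, send msg next, φ, ψ => send (fun a => msg (φ a)) fun m => (next m).comap ψ φ

theorem eval_comap {r : ℕ} (P : DetProtocol X r) (φ ψ : Y → X) (a b : Y) :
    (P.comap φ ψ).eval a b = P.eval (φ a) (ψ b) := by
  induction P generalizing φ ψ a b with
  | output f => rfl
  | send msg next ih => exact ih _ _ _ _ _

theorem messages_comap {r : ℕ} (P : DetProtocol X r) (φ ψ : Y → X) (a b : Y) :
    (P.comap φ ψ).messages a b = P.messages (φ a) (ψ b) := by
  induction P generalizing φ ψ a b with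
  | output f => rfl
  | send msg next ih => exact congrArg _ (ih _ _ _ _ _)

end DetProtocol

/-! ### The label error -/

section LabelError

variable {ι α : Type*} [Fintype ι] [DecidableEq ι] [Fintype α]

/-- The sum of the two error probabilities of `F` as a test that tells a uniformly random pair
(to be answered by `false`) from a uniformly random pair with one planted equality, at a uniformly
random coordinate (to be answered by `true`). -/
noncomputable def labelError (F : (ι → α) → (ι → α) → Bool) : ℝ :=
  (𝔼 x, 𝔼 y, if F x y then 1 else 0) +
    𝔼 i, 𝔼 x, 𝔼 y, if F x (update y i (x i)) then 0 else 1

theorem labelError_eq_one_of_left [Nonempty ι] [Nonempty α] (h : (ι → α) → Bool) :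
    labelError (fun x (_ : ι → α) => h x) = 1 := by
  simp only [labelError, Fintype.expect_const]
  rw [← expect_add_distrib]
  refine (expect_congr rfl fun x _ => ?_).trans Fintype.expect_one
  split_ifs <;> simp

/-- By symmetry of the planting, the second input remains uniform, so the two error probabilities
are complementary. -/
theorem labelError_eq_one_of_right [Nonempty ι] [Nonempty α] (h : (ι → α) → Bool) :
    labelError (fun (_ : ι → α) y => h y) = 1 := by
  simp only [labelError]
  have e : ∀ i : ι, 𝔼 x : ι → α, 𝔼 y : ι → α, (if h (update y i (x i)) then (0 : ℝ) else 1)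
      = 𝔼 y, if h y then (0 : ℝ) else 1 := by
    intro i
    rw [expect_expect_update_comm i (fun _ y => if h y then (0 : ℝ) else 1), Fintype.expect_const]
  simp only [e, Fintype.expect_const]
  rw [← expect_add_distrib]
  refine (expect_congr rfl fun x _ => ?_).trans Fintype.expect_one
  split_ifs <;> simp

end LabelError

/-! ### Merging blocks of coordinates -/

section Blocks

variable {m : ℕ} {σ α : Type*} [Fintype σ] [DecidableEq σ] [Fintype α]

/-- The label error of `F` for a fixed first input, where the coordinates come in blocks. -/
noncomputable def blockErrorAt (F : (Fin m → σ → α) → (Fin m → σ → α) → Bool)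
    (z : Fin m → σ → α) : ℝ :=
  (𝔼 y, if F z y then 1 else 0) +
    𝔼 k, 𝔼 i, 𝔼 y : Fin m → σ → α,
      if F z (update y k (update (y k) i (z k i))) then 0 else 1

/-- Restricting the first input of `F` to a set `S` can be undone, at a small cost in the label
error, by passing to the blocks as new coordinates. -/
theorem exists_labelError_le [DecidableEq α] [Nonempty α] [NeZero m] {b : ℕ} (hb : 0 < b)
    (hσ : Fintype.card σ = 8 ^ b) (F : (Fin m → σ → α) → (Fin m → σ → α) → Bool)
    (S : Finset (Fin m → σ → α)) (hS : S.Nonempty) :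
    ∃ ζ : (Fin m → σ → α) → Fin m → σ → α, (∀ x, ζ x ∈ S) ∧
      labelError (fun v u => F (ζ u) v) ≤ 𝔼 z ∈ S, blockErrorAt F z +
        (2 / b + 1 / (m * 8 ^ b * (b * Real.log 2)) *
          Real.log (Fintype.card (Fin m → σ → α) / S.card)) := by
  have : Nonempty σ := Fintype.card_pos_iff.mp (by rw [hσ]; positivity)
  have hm : (0 : ℝ) < m := by exact_mod_cast NeZero.pos m
  obtain ⟨ζ, hζ, hle⟩ := exists_selection (plantingKernel_nonneg (σ := σ) (α := α))
    sum_plantingKernel (fun ν h0 h1 => sum_max_plantingKernel_le hb hσ h0 h1) m S hS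
    -- The selection lemma sums over the blocks, whereas the label error averages over them; hence
    -- the factor `m`.
    (fun z => m * 𝔼 y, if F z y then 1 else 0)
    (fun k z w => 𝔼 y, if F z (update y k w) then 0 else 1)
    (fun k z w => expect_nonneg fun y _ => by split_ifs <;> simp)
    (fun k z w => expect_le univ_nonempty fun y _ => by split_ifs <;> simp)
  refine ⟨ζ, hζ, ?_⟩
  have eL : 𝔼 x, (m * (𝔼 y, if F (ζ x) y then (1 : ℝ) else 0)
        + ∑ k, 𝔼 y, if F (ζ x) (update y k (x k)) then (0 : ℝ) else 1)
      = m * labelError (fun v u => F (ζ u) v) := by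
    rw [labelError, expect_add_distrib, mul_add]
    congr 1
    · rw [← mul_expect, expect_comm]
    · rw [Finset.expect_sum_comm,
        Fintype.expect_eq_sum_div_card (ι := Fin m), Fintype.card_fin, mul_div_cancel₀ _ hm.ne']
      refine Finset.sum_congr rfl fun k _ => ?_
      -- In the reduced game the receiver of the dropped message moves first, so the planting must
      -- be carried from `u` over to `v`.
      rw [expect_expect_update_comm k (fun v u => if F (ζ u) v then (0 : ℝ) else 1), expect_comm]
  have eR : ∀ z, (m * (𝔼 y, if F z y then (1 : ℝ) else 0)
      + ∑ k, ∑ w, plantingKernel (z k) w * 𝔼 y, if F z (update y k w) then (0 : ℝ) else 1)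
      = m * blockErrorAt F z := by
    intro z
    rw [blockErrorAt, mul_add]
    congr 1
    rw [Fintype.expect_eq_sum_div_card, Fintype.card_fin, mul_div_cancel₀ _ hm.ne']
    refine Finset.sum_congr rfl fun k _ => ?_
    rw [sum_plantingKernel_mul]
    refine expect_congr rfl fun i _ => ?_
    rw [expect_comm, ← expect_expect_update k
      (fun y => if F z (update y k (update (y k) i (z k i))) then (0 : ℝ) else 1)]
    simp
  simp only [eR, ← mul_expect] at hle
  rw [eL] at hle
  refine le_of_mul_le_mul_left (hle.trans (le_of_eq ?_)) hm
  have hl : 0 < Real.log 2 := Real.log_pos (by norm_num)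
  have hb' : (0 : ℝ) < b := by exact_mod_cast hb
  simp only [Fintype.card_fun, Fintype.card_fin, Nat.cast_pow]
  field_simp

end Blocks

/-! ### Counting messages and bounding their entropy -/

theorem card_le_two_pow_of_length_lt (M : Finset (List Bool)) (C : ℕ)
    (hM : ∀ l ∈ M, l.length < C) : M.card ≤ 2 ^ C := by
  classical
  have hsub : M ⊆ (range C).biUnion fun k =>
      (univ : Finset (List.Vector Bool k)).image List.Vector.toList := by
    intro l hl
    exact Finset.mem_biUnion.mpr ⟨l.length, Finset.mem_range.mpr (hM l hl),
      Finset.mem_image.mpr ⟨⟨l, rfl⟩, mem_univ _, rfl⟩⟩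
  calc M.card ≤ ∑ k ∈ range C, 2 ^ k := by
        refine (Finset.card_le_card hsub).trans (Finset.card_biUnion_le.trans ?_)
        refine Finset.sum_le_sum fun k _ => Finset.card_image_le.trans ?_
        rw [Finset.card_univ, card_vector, Fintype.card_bool]
    _ ≤ 2 ^ C := (Nat.geomSum_lt le_rfl (fun k hk => Finset.mem_range.mp hk)).le

/-- The entropy of a function of a uniformly random point is at most the logarithm of the number of
its values. -/
theorem sum_card_fiber_mul_log_le {X Y : Type*} [Fintype X] [DecidableEq Y] [Nonempty X]
    (f : X → Y) :
    ∑ y ∈ univ.image f, ((univ.filter fun x => f x = y).card : ℝ) *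
        Real.log (Fintype.card X / (univ.filter fun x => f x = y).card)
      ≤ Fintype.card X * Real.log (univ.image f).card := by
  set s : Y → ℝ := fun y => ((univ.filter fun x => f x = y).card : ℝ) with hs
  set N : ℝ := (Fintype.card X : ℝ) with hN
  set K : ℝ := ((univ.image f).card : ℝ) with hK
  have hN0 : 0 < N := by simp only [hN]; exact_mod_cast Fintype.card_pos
  have hK0 : 0 < K := by
    simp only [hK]
    exact_mod_cast (univ_nonempty.image f).card_pos
  have hsum : ∑ y ∈ univ.image f, s y = N := by
    simp only [hs, hN]
    rw [← Nat.cast_sum, ← Finset.card_eq_sum_card_image f univ, Finset.card_univ]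
  -- This is `log t ≤ t - 1`; the corrections `N / K - s y` sum to zero over the `K` values.
  have key : ∀ y ∈ univ.image f, s y * Real.log (N / s y) ≤ s y * Real.log K + (N / K - s y) := by
    intro y hy
    have hpos : 0 < s y := by
      obtain ⟨x, -, hx⟩ := Finset.mem_image.mp hy
      simp only [hs]
      exact_mod_cast Finset.card_pos.mpr ⟨x, by simp [hx]⟩
    have h := Real.log_le_sub_one_of_pos (show 0 < N / s y / K by positivity)
    rw [Real.log_div (by positivity) hK0.ne'] at h
    have h2 := mul_le_mul_of_nonneg_left h hpos.le
    have h3 : s y * (N / s y / K - 1) = N / K - s y := by field_simp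
    rw [h3] at h2
    linarith
  refine (Finset.sum_le_sum key).trans (le_of_eq ?_)
  rw [Finset.sum_add_distrib, ← Finset.sum_mul, Finset.sum_sub_distrib, hsum, Finset.sum_const,
    nsmul_eq_mul, ← hK]
  field_simp
  ring

/-! ### Reading coordinates blockwise -/

section Reindex

variable {ι α : Type*} {m : ℕ} {σ : Type*}

/-- Reading a point of a product blockwise. -/
def unblock (q : Fin m × σ ≃ ι) : (Fin m → σ → α) ≃ (ι → α) where
  toFun x j := x (q.symm j).1 (q.symm j).2
  invFun y k i := y (q (k, i))
  left_inv x := by simp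
  right_inv y := by simp

theorem unblock_update [DecidableEq ι] [DecidableEq σ] (q : Fin m × σ ≃ ι) (y : Fin m → σ → α)
    (k : Fin m) (i : σ) (a : α) :
    unblock q (update y k (update (y k) i a)) = update (unblock q y) (q (k, i)) a := by
  ext j
  obtain ⟨⟨k', i'⟩, rfl⟩ := q.surjective j
  by_cases hk : k' = k
  · subst hk
    by_cases hi : i' = i
    · subst hi; simp [unblock]
    · simp [unblock, hi]
  · simp [unblock, hk]

theorem expect_blockErrorAt_unblock [Fintype ι] [DecidableEq ι] [Fintype σ] [DecidableEq σ]
    [Fintype α] (q : Fin m × σ ≃ ι) (F : (ι → α) → (ι → α) → Bool) :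
    𝔼 z, blockErrorAt (fun x y => F (unblock q x) (unblock q y)) z = labelError F := by
  simp only [blockErrorAt, labelError, expect_add_distrib]
  congr 1
  · refine Fintype.expect_equiv (unblock q) _ _ fun x => ?_
    exact Fintype.expect_equiv (unblock q) _ _ fun y => rfl
  · have e : ∀ f : ι → ℝ, 𝔼 j, f j = 𝔼 k, 𝔼 i, f (q (k, i)) := by
      intro f
      rw [← expect_product' univ univ (fun k i => f (q (k, i)))]
      exact (Fintype.expect_equiv q _ _ fun x => rfl).symm
    rw [e, expect_comm]
    refine expect_congr rfl fun k _ => ?_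
    rw [expect_comm]
    refine expect_congr rfl fun i _ => ?_
    refine Fintype.expect_equiv (unblock q) _ _ fun x => ?_
    refine Fintype.expect_equiv (unblock q) _ _ fun y => ?_
    have hu := unblock_update q y k i (x k i)
    have hx : unblock q x (q (k, i)) = x k i := by simp [unblock]
    simp only [hu, hx]

end Reindex

/-! ### Round elimination -/

/-- All messages of the protocol, on all inputs, have fewer than `C` bits. -/
def DetProtocol.IsShort {X : Type*} {r : ℕ} (P : DetProtocol X r) (C : ℕ) : Prop :=
  ∀ a b, ∀ l ∈ P.messages a b, l.length < C

/-- Round elimination: the first message of a protocol can be dropped if `8 ^ b` coordinates at a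
time are merged into one. -/
theorem le_labelError_of_forall_reduced {ι α σ : Type*} {m : ℕ} [Fintype ι] [DecidableEq ι]
    [Fintype α] [Nonempty α] [Fintype σ] [DecidableEq σ] [NeZero m] {b : ℕ} (hb : 0 < b)
    (hσ : Fintype.card σ = 8 ^ b) (q : Fin m × σ ≃ ι) {r C : ℕ} (msg : (ι → α) → List Bool)
    (next : List Bool → DetProtocol (ι → α) r) (hP : (DetProtocol.send msg next).IsShort C)
    {t : ℝ} (ht : ∀ P : DetProtocol (Fin m → σ → α) r, P.IsShort C → t ≤ labelError P.eval) :
    t ≤ labelError (DetProtocol.send msg next).eval + (C / Fintype.card ι + 2) / b := by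
  classical
  have hm : (0 : ℝ) < m := by exact_mod_cast NeZero.pos m
  have hb' : (0 : ℝ) < b := by exact_mod_cast hb
  have hl : 0 < Real.log 2 := Real.log_pos (by norm_num)
  set F : (Fin m → σ → α) → (Fin m → σ → α) → Bool := fun x y =>
    (DetProtocol.send msg next).eval (unblock q x) (unblock q y) with hF
  set f : (Fin m → σ → α) → List Bool := fun x => msg (unblock q x) with hf
  set S : List Bool → Finset (Fin m → σ → α) := fun l => univ.filter fun x => f x = l with hS
  set N : ℝ := (Fintype.card (Fin m → σ → α) : ℝ) with hN
  have hN0 : 0 < N := by simp only [hN]; exact_mod_cast Fintype.card_pos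
  set lam : ℝ := 1 / (m * 8 ^ b * (b * Real.log 2)) with hlam
  have hlam0 : 0 ≤ lam := by positivity
  -- For each possible first message `l`, the reduced protocol starts at `next l`, with the old
  -- receiver active. The inequality is weighted by the size of the fibre, ready to be summed over
  -- `l`.
  have hstep : ∀ l ∈ univ.image f, (S l).card * t ≤ ∑ z ∈ S l, blockErrorAt F z
      + ((S l).card * (2 / b) + lam * ((S l).card * Real.log (N / (S l).card))) := by
    intro l hlm
    obtain ⟨x, -, hx⟩ := Finset.mem_image.mp hlm
    have hne : (S l).Nonempty := ⟨x, by simp [hS, hx]⟩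
    obtain ⟨ζ, hζ, hle⟩ := exists_labelError_le hb hσ F (S l) hne
    have hζl : ∀ u, msg (unblock q (ζ u)) = l := fun u => by
      have := hζ u
      simpa [hS, hf] using this
    have hshort : ((next l).comap (unblock q) fun u => unblock q (ζ u)).IsShort C := by
      intro v u l' hl'
      rw [DetProtocol.messages_comap] at hl'
      refine hP (unblock q (ζ u)) (unblock q v) l' ?_
      rw [DetProtocol.messages, hζl]
      exact List.mem_cons_of_mem _ hl'
    have h1 := ht _ hshort
    have heval : ((next l).comap (unblock q) fun u => unblock q (ζ u)).eval
        = fun v u => F (ζ u) v := by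
      funext v u
      rw [DetProtocol.eval_comap]
      simp only [hF, DetProtocol.eval, hζl]
    rw [heval] at h1
    have hc : (0 : ℝ) < (S l).card := by exact_mod_cast hne.card_pos
    have h2 := mul_le_mul_of_nonneg_left (h1.trans hle) hc.le
    refine h2.trans (le_of_eq ?_)
    rw [Finset.expect_eq_sum_div_card, mul_add, mul_div_cancel₀ _ hc.ne']
    ring
  have hsum := Finset.sum_le_sum hstep
  have hent := sum_card_fiber_mul_log_le f
  have hcard : ∑ l ∈ univ.image f, ((S l).card : ℝ) = N := by
    simp only [hS, hN]
    rw [← Nat.cast_sum, ← Finset.card_eq_sum_card_image f univ, Finset.card_univ]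
  have hfib : ∑ l ∈ univ.image f, ∑ z ∈ S l, blockErrorAt F z = N * labelError
      (DetProtocol.send msg next).eval := by
    rw [← expect_blockErrorAt_unblock q, Fintype.expect_eq_sum_div_card, mul_div_cancel₀ _ hN0.ne']
    exact Finset.sum_fiberwise_of_maps_to (fun x _ => Finset.mem_image_of_mem f (mem_univ x)) _
  rw [← Finset.sum_mul, hcard, Finset.sum_add_distrib, Finset.sum_add_distrib, ← Finset.sum_mul,
    hcard, ← Finset.mul_sum, hfib] at hsum
  have hlogM : Real.log (univ.image f).card ≤ C * Real.log 2 := by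
    have h1 : (univ.image f).card ≤ 2 ^ C := by
      refine card_le_two_pow_of_length_lt _ C fun l hl => ?_
      obtain ⟨x, -, rfl⟩ := Finset.mem_image.mp hl
      refine hP (unblock q x) (unblock q x) _ ?_
      rw [DetProtocol.messages]
      exact List.mem_cons_self
    rw [← Real.log_pow]
    refine Real.log_le_log ?_ (by exact_mod_cast h1)
    exact_mod_cast (univ_nonempty.image f).card_pos
  have hent2 := mul_le_mul_of_nonneg_left
    (hent.trans (mul_le_mul_of_nonneg_left hlogM hN0.le)) hlam0
  have hι : (Fintype.card ι : ℝ) = m * 8 ^ b := by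
    rw [← Fintype.card_congr q]; simp [hσ]
  have hfin : N * t ≤ N * (labelError (DetProtocol.send msg next).eval
      + (C / Fintype.card ι + 2) / b) := by
    refine hsum.trans ((add_le_add_right (add_le_add_right hent2 _) _).trans (le_of_eq ?_))
    rw [hι, hlam]
    field_simp
    ring
  exact le_of_mul_le_mul_left hfin hN0

/-- Protocols with few rounds and short messages do not notice a planted equality. -/
theorem one_le_labelError_add_sum (r C : ℕ) :
    ∀ (N b : ℕ → ℕ), (∀ j < r, 0 < b j) → (∀ j ≤ r, 0 < N j) →
      (∀ j < r, N j = N (j + 1) * 8 ^ b j) →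
      ∀ (ι α : Type) [Fintype ι] [DecidableEq ι] [Fintype α] [Nonempty α],
        Fintype.card ι = N 0 → ∀ P : DetProtocol (ι → α) r, P.IsShort C →
          1 ≤ labelError P.eval + ∑ j ∈ range r, ((C : ℝ) / N j + 2) / b j := by
  induction r with
  | zero =>
    intro N b _ hN _ ι α _ _ _ _ hι P _
    have : Nonempty ι := Fintype.card_pos_iff.mp (hι ▸ hN 0 le_rfl)
    cases P with
    | output f =>
      rw [Finset.sum_range_zero, add_zero]
      exact (labelError_eq_one_of_left f).ge
  | succ r ih =>
    intro N b hb hN hNb ι α _ _ _ _ hι P hP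
    have : Nonempty ι := Fintype.card_pos_iff.mp (hι ▸ hN 0 (Nat.zero_le _))
    cases P with
    | output f =>
      have h1 := labelError_eq_one_of_left f
      have h2 : 0 ≤ ∑ j ∈ range (r + 1), ((C : ℝ) / N j + 2) / b j :=
        Finset.sum_nonneg fun j _ => by positivity
      change 1 ≤ labelError (fun x (_ : ι → α) => f x) + _
      linarith
    | send msg next =>
      have : NeZero (N 1) := ⟨(hN 1 (by omega)).ne'⟩
      have q : Fin (N 1) × Fin (8 ^ b 0) ≃ ι := Fintype.equivOfCardEq (by
        rw [hι, hNb 0 (Nat.succ_pos _)]; simp)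
      have h := le_labelError_of_forall_reduced (hb 0 (Nat.succ_pos _)) (Fintype.card_fin _) q
        msg next hP (t := 1 - ∑ j ∈ range r, ((C : ℝ) / N (j + 1) + 2) / b (j + 1))
        (fun P' hP' => by
          have := ih (fun j => N (j + 1)) (fun j => b (j + 1))
            (fun j hj => hb _ (Nat.succ_lt_succ hj)) (fun j hj => hN _ (Nat.succ_le_succ hj))
            (fun j hj => hNb _ (Nat.succ_lt_succ hj)) (Fin (N 1)) (Fin (8 ^ b 0) → α)
            (Fintype.card_fin _) P' hP'
          linarith)
      rw [Finset.sum_range_succ', ← hι]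
      linarith

/-- Empty messages carry no information, so whoever declares the output uses only the own input; the
number of turns decides which player that is. -/
theorem DetProtocol.eval_eq_of_isShort_one {X : Type*} {r : ℕ} (P : DetProtocol X r)
    (hP : P.IsShort 1) :
    (∃ h : X → Bool, P.eval = fun a _ => h a) ∨ ∃ h : X → Bool, P.eval = fun _ b => h b := by
  induction P with
  | output f => exact Or.inl ⟨f, rfl⟩
  | send msg next ih =>
    have hmsg : ∀ a, msg a = [] := fun a =>
      List.length_eq_zero_iff.mp (Nat.lt_one_iff.mp (hP a a (msg a) List.mem_cons_self))
    have hnext : (next []).IsShort 1 := by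
      intro b a l hl
      refine hP a b l (List.mem_cons_of_mem _ ?_)
      rwa [hmsg]
    have he : ∀ a b, (send msg next).eval a b = (next []).eval b a := fun a b => by
      rw [DetProtocol.eval, hmsg]
    rcases ih [] hnext with ⟨h, hh⟩ | ⟨h, hh⟩
    · exact Or.inr ⟨h, by funext a b; rw [he, hh]⟩
    · exact Or.inl ⟨h, by funext a b; rw [he, hh]⟩

theorem DetProtocol.labelError_eq_one_of_isShort_one {ι α : Type*} [Fintype ι] [DecidableEq ι]
    [Fintype α] [Nonempty ι] [Nonempty α] {r : ℕ} (P : DetProtocol (ι → α) r) (hP : P.IsShort 1) :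
    labelError P.eval = 1 := by
  rcases P.eval_eq_of_isShort_one hP with ⟨h, hh⟩ | ⟨h, hh⟩
  · rw [hh]; exact labelError_eq_one_of_left h
  · rw [hh]; exact labelError_eq_one_of_right h

theorem DetProtocol.isShort_one_of_zero {X : Type*} (P : DetProtocol X 0) : P.IsShort 1 := by
  cases P with
  | output f => intro a b l hl; simp [DetProtocol.messages] at hl

/-! ### Integrating over the common randomness -/

section Expectation

variable {Ω : Type*} [MeasurableSpace Ω] {μ : Measure Ω} {ι : Type*} [Fintype ι]

theorem integrable_expect {f : ι → Ω → ℝ} (hf : ∀ i, Integrable (f i) μ) :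
    Integrable (fun ω => 𝔼 i, f i ω) μ := by
  simp only [Fintype.expect_eq_sum_div_card]
  exact (integrable_finsetSum _ fun i _ => hf i).div_const _

theorem integral_expect {f : ι → Ω → ℝ} (hf : ∀ i, Integrable (f i) μ) :
    ∫ ω, 𝔼 i, f i ω ∂μ = 𝔼 i, ∫ ω, f i ω ∂μ := by
  simp only [Fintype.expect_eq_sum_div_card]
  rw [integral_div, integral_finsetSum _ fun i _ => hf i]

theorem integrable_ite [IsProbabilityMeasure μ] {g : Ω → Bool} (hg : Measurable g) (a b : ℝ) :
    Integrable (fun ω => if g ω then a else b) μ := by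
  refine Integrable.of_bound (C := max |a| |b|) ?_ (Filter.Eventually.of_forall fun ω => ?_)
  · exact (Measurable.ite (hg (measurableSet_singleton true)) measurable_const
      measurable_const).aestronglyMeasurable
  · split_ifs
    · exact le_max_left _ _
    · exact le_max_right _ _

theorem integral_ite_le [IsProbabilityMeasure μ] {g : Ω → Bool} (hg : Measurable g) {v : Bool}
    (h : μ {ω | g ω ≠ v} ≤ 1 / 3) :
    ∫ ω, (if g ω = v then (0 : ℝ) else 1) ∂μ ≤ 1 / 3 := by
  have hm : MeasurableSet {ω | g ω ≠ v} := (hg (measurableSet_singleton v)).compl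
  have e : (fun ω => if g ω = v then (0 : ℝ) else 1) = {ω | g ω ≠ v}.indicator 1 := by
    funext ω
    by_cases hc : g ω = v <;> simp [hc]
  rw [e, integral_indicator_one hm, Measure.real]
  have := ENNReal.toReal_mono (by simp) h
  simpa using this

end Expectation

theorem existsEqual_comm (n t : ℕ) (x y : Fin n → Fin t) :
    existsEqual n t x y = existsEqual n t y x := by
  simp only [existsEqual, eq_comm]

/-! ### Padding and fixing the randomness -/

section Padding

variable {n n₀ t : ℕ}

/-- Extending a vector by a constant. -/
def padWith (v : Fin t) (x : Fin n₀ → Fin t) (i : Fin n) : Fin t :=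
  if h : (i : ℕ) < n₀ then x ⟨i, h⟩ else v

/-- The two players pad by different constants, so no equality arises outside the original
coordinates. -/
theorem existsEqual_padWith (hn : n₀ ≤ n) {v w : Fin t} (hvw : v ≠ w) (x y : Fin n₀ → Fin t) :
    existsEqual n t (padWith v x) (padWith w y) = decide (∃ i, x i = y i) := by
  rw [existsEqual, decide_eq_decide]
  constructor
  · rintro ⟨i, hi⟩
    by_cases h : (i : ℕ) < n₀
    · exact ⟨⟨i, h⟩, by simpa [padWith, h] using hi⟩
    · exact absurd (by simpa [padWith, h] using hi) hvw
  · rintro ⟨i, hi⟩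
    exact ⟨⟨i, i.2.trans_le hn⟩, by simpa [padWith] using hi⟩

end Padding

/-- A union bound over the coordinates. -/
theorem expect_exists_eq_le {ι α : Type*} [Fintype ι] [DecidableEq ι] [Fintype α] [DecidableEq α]
    [Nonempty α] :
    𝔼 x : ι → α, 𝔼 y : ι → α, (if ∃ i, x i = y i then (1 : ℝ) else 0)
      ≤ Fintype.card ι / Fintype.card α := by
  refine expect_le univ_nonempty fun x _ => ?_
  calc 𝔼 y : ι → α, (if ∃ i, x i = y i then (1 : ℝ) else 0)
      ≤ 𝔼 y : ι → α, ∑ i, if x i = y i then (1 : ℝ) else 0 := by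
        refine expect_le_expect fun y _ => ?_
        split_ifs with h
        · obtain ⟨i, hi⟩ := h
          calc (1 : ℝ) = if x i = y i then (1 : ℝ) else 0 := by simp [hi]
            _ ≤ _ := Finset.single_le_sum (f := fun i => if x i = y i then (1 : ℝ) else 0)
                (fun j _ => by split_ifs <;> simp) (mem_univ i)
        · exact Finset.sum_nonneg fun j _ => by split_ifs <;> simp
    _ = ∑ i, 𝔼 a : α, if x i = a then (1 : ℝ) else 0 := by
        rw [Finset.expect_sum_comm]
        exact Finset.sum_congr rfl fun i _ =>
          expect_coord i fun a => if x i = a then (1 : ℝ) else 0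
    _ = _ := by
        simp only [Fintype.expect_eq_sum_div_card, Finset.sum_ite_eq, Finset.mem_univ, if_true]
        simp [div_eq_mul_inv]

/-- From a randomized protocol for exists-equal to a deterministic one which often notices a planted
equality. -/
theorem exists_detProtocol_labelError_le {n n₀ r : ℕ} (hn : 1 ≤ n) (hn₀ : n₀ ≤ n)
    (h₀ : 0 < n₀) {Ω : Type*}
    [MeasurableSpace Ω] (μ : Measure Ω) [IsProbabilityMeasure μ]
    (P : RandProtocol Ω (Fin n → Fin (4 * n)) r)
    (herr : P.error μ (existsEqual n (4 * n)) ≤ 1 / 3) (L : ℝ) (hL : ¬ P.SendsMessageOfSize μ L) :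
    ∃ D : DetProtocol (Fin n₀ → Fin (4 * n)) r,
      (∀ a b, ∀ l ∈ D.messages a b, (l.length : ℝ) < L) ∧
      labelError D.eval ≤ 2 / 3 + n₀ / (4 * n) := by
  have hE : ∀ a b, μ {ω | (P.det ω).eval a b ≠ existsEqual n (4 * n) a b} ≤ 1 / 3 := by
    have h : ∀ x y, μ {ω | P.eval ω x y ≠ existsEqual n (4 * n) x y} ≤ 1 / 3 := fun x y =>
      (le_iSup₂ (f := fun x y => μ {ω | P.eval ω x y ≠ existsEqual n (4 * n) x y}) x y).trans herr
    intro a b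
    cases hf : P.first with
    | alice => simpa [RandProtocol.eval, hf] using h a b
    | bob => simpa [RandProtocol.eval, hf, existsEqual_comm n (4 * n) b a] using h b a
  have hM : ∀ a b, μ {ω | ∃ l ∈ (P.det ω).messages a b, L ≤ (l.length : ℝ)} = 0 := by
    simp only [RandProtocol.SendsMessageOfSize, not_exists, not_lt, nonpos_iff_eq_zero] at hL
    intro a b
    cases hf : P.first with
    | alice => simpa [RandProtocol.messages, hf] using hL a b
    | bob => simpa [RandProtocol.messages, hf] using hL b a
  let v : Fin (4 * n) := ⟨0, by omega⟩
  let w : Fin (4 * n) := ⟨1, by omega⟩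
  have hvw : v ≠ w := by simp [v, w]
  have : Nonempty (Fin (4 * n)) := ⟨v⟩
  have : Nonempty (Fin n₀) := ⟨⟨0, h₀⟩⟩
  let D : Ω → DetProtocol (Fin n₀ → Fin (4 * n)) r := fun ω =>
    (P.det ω).comap (padWith v) (padWith w)
  have hDmeas : ∀ a b, Measurable fun ω => (D ω).eval a b := fun a b => by
    simp only [D, DetProtocol.eval_comap]
    exact P.measurable_eval _ _
  have hDerr : ∀ a b, μ {ω | (D ω).eval a b ≠ decide (∃ i, a i = b i)} ≤ 1 / 3 := fun a b => by
    simp only [D, DetProtocol.eval_comap]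
    rw [← existsEqual_padWith hn₀ hvw]
    exact hE _ _
  set Bad : Set Ω := ⋃ a, ⋃ b, {ω | ∃ l ∈ (D ω).messages a b, L ≤ (l.length : ℝ)} with hBad
  have hBad0 : μ Bad = 0 := by
    refine measure_iUnion_null fun a => measure_iUnion_null fun b => ?_
    simp only [D, DetProtocol.messages_comap]
    exact hM _ _
  have hI1 : ∀ a b, Integrable (fun ω => if (D ω).eval a b then (1 : ℝ) else 0) μ :=
    fun a b => integrable_ite (hDmeas a b) 1 0
  have hI0 : ∀ a b, Integrable (fun ω => if (D ω).eval a b then (0 : ℝ) else 1) μ :=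
    fun a b => integrable_ite (hDmeas a b) 0 1
  have hA : Integrable (fun ω => 𝔼 x, 𝔼 y, if (D ω).eval x y then (1 : ℝ) else 0) μ :=
    integrable_expect fun x => integrable_expect fun y => hI1 x y
  have hB : Integrable (fun ω => 𝔼 i, 𝔼 x : Fin n₀ → Fin (4 * n), 𝔼 y,
      if (D ω).eval x (update y i (x i)) then (0 : ℝ) else 1) μ :=
    integrable_expect fun i => integrable_expect fun x => integrable_expect fun y => hI0 _ _
  -- One value of the randomness has label error at most the mean and also avoids the null set where
  -- some input pair causes a long message.
  obtain ⟨ω, hω, hle⟩ := exists_notMem_null_le_integral (hA.add hB) hBad0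
  refine ⟨D ω, fun a b l hl => ?_, hle.trans ?_⟩
  · by_contra hcon
    exact hω (Set.mem_iUnion.mpr ⟨a, Set.mem_iUnion.mpr ⟨b, l, hl, not_lt.mp hcon⟩⟩)
  · simp only [Pi.add_apply]
    rw [integral_add hA hB]
    have e1 : ∫ ω, 𝔼 x, 𝔼 y, (if (D ω).eval x y then (1 : ℝ) else 0) ∂μ
        ≤ 1 / 3 + n₀ / (4 * n) := by
      rw [integral_expect fun x => integrable_expect fun y => hI1 x y]
      simp only [integral_expect fun y => hI1 _ y]
      have hp : ∀ x y : Fin n₀ → Fin (4 * n), ∫ ω, (if (D ω).eval x y then (1 : ℝ) else 0) ∂μ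
          ≤ 1 / 3 + if ∃ i, x i = y i then (1 : ℝ) else 0 := by
        intro x y
        split_ifs with h
        · have : ∫ ω, (if (D ω).eval x y then (1 : ℝ) else 0) ∂μ ≤ ∫ _ω, (1 : ℝ) ∂μ :=
            integral_mono (hI1 x y) (integrable_const _) fun ω => by
              dsimp only; split_ifs <;> simp
          simp at this
          linarith
        · have h1 := hDerr x y
          rw [decide_eq_false h] at h1
          have h2 := integral_ite_le (hDmeas x y) h1
          have e : ∀ ω, (if (D ω).eval x y then (1 : ℝ) else 0)
              = if (D ω).eval x y = false then (0 : ℝ) else 1 := fun ω => by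
            cases (D ω).eval x y <;> simp
          simp only [e]
          linarith
      calc _ ≤ 𝔼 x : Fin n₀ → Fin (4 * n), 𝔼 y : Fin n₀ → Fin (4 * n),
            (1 / 3 + if ∃ i, x i = y i then (1 : ℝ) else 0) :=
            expect_le_expect fun x _ => expect_le_expect fun y _ => hp x y
        _ ≤ _ := by
          simp only [expect_add_distrib, Fintype.expect_const]
          have := expect_exists_eq_le (ι := Fin n₀) (α := Fin (4 * n))
          simp only [Fintype.card_fin] at this
          push_cast at this
          refine add_le_add_right (le_trans (le_of_eq ?_) this) _
          congr!
    have e2 : ∫ ω, 𝔼 i, 𝔼 x : Fin n₀ → Fin (4 * n), 𝔼 y,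
        (if (D ω).eval x (update y i (x i)) then (0 : ℝ) else 1) ∂μ ≤ 1 / 3 := by
      rw [integral_expect fun i => integrable_expect fun x => integrable_expect fun y => hI0 _ _]
      refine expect_le univ_nonempty fun i _ => ?_
      rw [integral_expect fun x => integrable_expect fun y => hI0 _ _]
      refine expect_le univ_nonempty fun x _ => ?_
      rw [integral_expect fun y => hI0 _ _]
      refine expect_le univ_nonempty fun y _ => ?_
      have h1 := hDerr x (update y i (x i))
      rw [decide_eq_true ⟨i, by simp⟩] at h1
      exact integral_ite_le (hDmeas _ _) h1
    linarith

/-! ### Tower growth and the choice of block sizes -/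

theorem three_halves_mul_le_two_rpow {x : ℝ} (hx : 0 ≤ x) : 3 / 2 * x ≤ (2 : ℝ) ^ x := by
  have h1 := Real.add_one_le_exp (x * Real.log 2 - 1)
  have h2 : Real.exp (x * Real.log 2 - 1) * Real.exp 1 = (2 : ℝ) ^ x := by
    rw [← Real.exp_add, Real.rpow_def_of_pos (by norm_num)]
    congr 1; ring
  have h3 : (2.7 : ℝ) ≤ Real.exp 1 := by linarith [Real.exp_one_gt_d9]
  have h4 : (0.69 : ℝ) ≤ Real.log 2 := by linarith [Real.log_two_gt_d9]
  rw [← h2]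
  have h5 : x * 0.69 ≤ Real.exp (x * Real.log 2 - 1) := by nlinarith
  have h6 : x * 0.69 * 2.7 ≤ Real.exp (x * Real.log 2 - 1) * Real.exp 1 :=
    mul_le_mul h5 h3 (by norm_num) (Real.exp_pos _).le
  linarith

theorem exists_nat_cubic_le_add_pow :
    ∃ K : ℕ, ∀ j : ℕ, 48 * ((j : ℝ) + 1) ^ 3 + 2 * j ≤ K + (3 / 2 : ℝ) ^ j / 16 := by
  have h := tendsto_pow_const_div_const_pow_of_one_lt 3 (show (1 : ℝ) < 3 / 2 by norm_num)
  -- For `j ≥ 1` the left side is at most `48 * (2 * j) ^ 3 + 2 * j ≤ 386 * j ^ 3`.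
  have h' := (h.eventually (gt_mem_nhds (show (0 : ℝ) < 1 / 16 / 386 by norm_num)))
  obtain ⟨A, hA⟩ := Filter.eventually_atTop.mp h'
  refine ⟨48 * (A + 2) ^ 3 + 2 * (A + 1), fun j => ?_⟩
  have hp : (0 : ℝ) < (3 / 2 : ℝ) ^ j := by positivity
  push_cast
  rcases le_total j (A + 1) with hj | hj
  · have hj' : (j : ℝ) ≤ A + 1 := by exact_mod_cast hj
    have : ((j : ℝ) + 1) ^ 3 ≤ ((A : ℝ) + 2) ^ 3 :=
      pow_le_pow_left₀ (by positivity) (by linarith) 3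
    linarith
  · have hj1 : (1 : ℝ) ≤ j := by exact_mod_cast (by omega : 1 ≤ j)
    have h1 := hA j (by omega)
    rw [div_lt_iff₀ hp] at h1
    have h2 : ((j : ℝ) + 1) ^ 3 ≤ (2 * j) ^ 3 :=
      pow_le_pow_left₀ (by positivity) (by linarith) 3
    have h3 : (j : ℝ) ≤ j ^ 3 := by nlinarith [mul_self_nonneg ((j : ℝ) - 1)]
    have h4 : (0 : ℝ) ≤ 48 * ((A : ℝ) + 2) ^ 3 + 2 * (A + 1) := by positivity
    rw [mul_pow] at h2
    linarith

section Tower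

variable {r : ℕ} {ℓ : ℕ → ℝ}

theorem pow_le_tower (h0 : 1 ≤ ℓ 0) (hs : ∀ j < r, ℓ (j + 1) = (2 : ℝ) ^ ℓ j) :
    ∀ j ≤ r, (3 / 2 : ℝ) ^ j ≤ ℓ j := by
  intro j
  induction j with
  | zero => intro _; simpa using h0
  | succ j ih =>
    intro hj
    have h1 := ih (by omega)
    rw [hs j (by omega), pow_succ]
    have h2 : (0 : ℝ) ≤ (3 / 2 : ℝ) ^ j := by positivity
    have := three_halves_mul_le_two_rpow (h2.trans h1)
    linarith

theorem sum_tower_le (h0 : 1 ≤ ℓ 0) (hs : ∀ j < r, ℓ (j + 1) = (2 : ℝ) ^ ℓ j) :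
    ∀ j ≤ r, ∑ i ∈ range (j + 1), ℓ i ≤ 3 * ℓ j := by
  intro j
  induction j with
  | zero => intro _; simp; linarith
  | succ j ih =>
    intro hj
    rw [Finset.sum_range_succ]
    have h1 := ih (by omega)
    have h2 := pow_le_tower h0 hs j (by omega)
    have h3 : (0 : ℝ) ≤ (3 / 2 : ℝ) ^ j := by positivity
    have h4 := three_halves_mul_le_two_rpow (h3.trans h2)
    rw [← hs j (by omega)] at h4
    linarith

theorem tower_zero_le (h0 : 1 ≤ ℓ 0) (hs : ∀ j < r, ℓ (j + 1) = (2 : ℝ) ^ ℓ j) :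
    ∀ j ≤ r, ℓ 0 ≤ ℓ j := by
  intro j
  induction j with
  | zero => intro _; exact le_rfl
  | succ j ih =>
    intro hj
    have h1 := ih (by omega)
    have h4 := three_halves_mul_le_two_rpow (x := ℓ j) (by linarith)
    rw [← hs j (by omega)] at h4
    linarith

end Tower

/-- The logarithm, to base 8, of the number of coordinates that are merged in a round. -/
noncomputable def blockExponent (ℓ : ℕ → ℝ) (j : ℕ) : ℕ :=
  16 * ((j + 1) * (j + 2)) + ⌊ℓ j / 18⌋₊

/-- The sum of the tower is at most three times its last term, so the divisor 18 makes the tower's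
share of the base-2 exponent at most `3 * 3 * ℓ j / 18 = ℓ j / 2`. The merging thus uses about the
square root of `ℓ (j + 1) = 2 ^ ℓ j`. -/
theorem eight_pow_sum_blockExponent_le {r : ℕ} {ℓ : ℕ → ℝ} (h0 : 1 ≤ ℓ 0)
    (hs : ∀ j < r, ℓ (j + 1) = (2 : ℝ) ^ ℓ j) {j : ℕ} (hj : j < r) :
    (8 : ℝ) ^ ∑ i ∈ range (j + 1), blockExponent ℓ i
      ≤ (2 : ℝ) ^ (48 * ((j : ℝ) + 2) ^ 3 + ℓ j / 2) := by
  have hW : ∀ k : ℕ, ∑ i ∈ range k, (16 * (((i : ℝ) + 1) * (i + 2))) ≤ 16 * ((k : ℝ) + 1) ^ 3 := by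
    intro k
    induction k with
    | zero => simp
    | succ k ih =>
      rw [Finset.sum_range_succ]
      push_cast
      have : (0 : ℝ) ≤ k := Nat.cast_nonneg k
      nlinarith [sq_nonneg (k : ℝ)]
  have hb : ((∑ i ∈ range (j + 1), blockExponent ℓ i : ℕ) : ℝ)
      ≤ 16 * ((j : ℝ) + 2) ^ 3 + ℓ j / 6 := by
    have h1 : ∀ i ∈ range (j + 1), (blockExponent ℓ i : ℝ)
        ≤ 16 * (((i : ℝ) + 1) * (i + 2)) + ℓ i / 18 := by
      intro i hi
      have h3 := pow_le_tower h0 hs i (by have := Finset.mem_range.mp hi; omega)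
      have h4 : (0 : ℝ) ≤ (3 / 2 : ℝ) ^ i := by positivity
      have h2 := Nat.floor_le (show 0 ≤ ℓ i / 18 by linarith)
      simp only [blockExponent]
      push_cast
      linarith
    have h2 := sum_tower_le h0 hs j hj.le
    have h3 := hW (j + 1)
    rw [Nat.cast_sum]
    refine (Finset.sum_le_sum h1).trans ?_
    rw [Finset.sum_add_distrib, ← Finset.sum_div]
    push_cast at h3
    rw [show (j : ℝ) + 1 + 1 = j + 2 by ring] at h3
    linarith
  rw [show (8 : ℝ) = (2 : ℝ) ^ (3 : ℝ) by norm_num, ← Real.rpow_mul_natCast (by norm_num)]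
  exact Real.rpow_le_rpow_of_exponent_le (by norm_num) (by linarith)

/-- The choice of the block sizes. -/
theorem exists_blocks {K : ℕ}
    (hK : ∀ j : ℕ, 48 * ((j : ℝ) + 1) ^ 3 + 2 * j ≤ K + (3 / 2 : ℝ) ^ j / 16)
    {r n C : ℕ} {ℓ : ℕ → ℝ} (hr : 0 < r) (h0 : 1 ≤ ℓ 0)
    (hs : ∀ j < r, ℓ (j + 1) = (2 : ℝ) ^ ℓ j) (hn : ℓ r = n) {c : ℝ}
    (hcdef : c = (2 : ℝ) ^ (-(8 * K + 15) : ℝ)) (hc : 1 < c * (n * ℓ 0))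
    (hC : (C : ℝ) ≤ 2 * (c * (n * ℓ 0))) :
    ∃ N b : ℕ → ℕ, (∀ j < r, 0 < b j) ∧ (∀ j ≤ r, 0 < N j) ∧
      (∀ j < r, N j = N (j + 1) * 8 ^ b j) ∧ 3 * N 0 ≤ n ∧
      ∑ j ∈ range r, ((C : ℝ) / N j + 2) / b j < 1 / 4 := by
  have hc0 : 0 < c := by rw [hcdef]; positivity
  set b := blockExponent ℓ with hbdef
  set B : ℕ → ℕ := fun j => ∑ i ∈ range j, b i with hB
  have hBmono : Monotone B := fun i j hij =>
    Finset.sum_le_sum_of_subset (Finset.range_mono hij)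
  have hBsucc : ∀ j, B (j + 1) = B j + b j := fun j => Finset.sum_range_succ _ _
  have hlast : (n : ℝ) = (2 : ℝ) ^ ℓ (r - 1) := by
    rw [← hn, ← hs (r - 1) (by omega)]; congr 1; omega
  have hn0 : (0 : ℝ) < n := by rw [hlast]; positivity
  -- From `1 < c * n ^ 2` with `n = 2 ^ ℓ (r - 1)`; this is the purpose of `8 * K` in the exponent
  -- of `c`.
  have hlarge : 4 * (K : ℝ) + 7 ≤ ℓ (r - 1) := by
    have h1 : ℓ 0 ≤ n := by rw [← hn]; exact tower_zero_le h0 hs r le_rfl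
    have h2 : 1 < c * (n * n) :=
      hc.trans_le (mul_le_mul_of_nonneg_left (mul_le_mul_of_nonneg_left h1 hn0.le) hc0.le)
    rw [hcdef, hlast, ← Real.rpow_add (by norm_num), ← Real.rpow_add (by norm_num)] at h2
    have h3 := (Real.one_lt_rpow_iff_of_pos (by norm_num)).mp h2
    rcases h3 with ⟨-, h3⟩ | ⟨h3, -⟩
    · linarith
    · norm_num at h3
  have hfit : 3 * 8 ^ B r ≤ n := by
    have h1 := eight_pow_sum_blockExponent_le h0 hs (show r - 1 < r by omega)
    rw [show r - 1 + 1 = r by omega] at h1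
    have hcast : ((r - 1 : ℕ) : ℝ) = r - 1 := by rw [Nat.cast_sub hr]; simp
    rw [hcast] at h1
    have h2 := hK r
    have h3 := pow_le_tower h0 hs (r - 1) (by omega)
    have h4 : (3 / 2 : ℝ) ^ r = (3 / 2 : ℝ) ^ (r - 1) * (3 / 2) := by
      rw [← pow_succ]; congr 1; omega
    have hr1 : (1 : ℝ) ≤ r := by exact_mod_cast hr
    have h5 : (2 : ℝ) + (48 * ((r : ℝ) - 1 + 2) ^ 3 + ℓ (r - 1) / 2) ≤ ℓ (r - 1) := by
      rw [show (r : ℝ) - 1 + 2 = r + 1 by ring]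
      rw [h4] at h2
      linarith
    have h6 : (3 : ℝ) * 8 ^ B r ≤ n := by
      calc (3 : ℝ) * 8 ^ B r ≤ (2 : ℝ) ^ (2 : ℝ)
            * (2 : ℝ) ^ (48 * ((r : ℝ) - 1 + 2) ^ 3 + ℓ (r - 1) / 2) := by
            refine mul_le_mul (by norm_num) h1 (by positivity) (by positivity)
        _ ≤ n := by
            rw [← Real.rpow_add (by norm_num), hlast]
            exact Real.rpow_le_rpow_of_exponent_le (by norm_num) h5
    exact_mod_cast h6
  -- Since `q ≥ 1`, rounding down loses at most a factor 2, so `N 0` lies between `n / 6` and `n /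
  -- 3`. The factor 3 keeps accidental equalities rare.
  set q : ℕ := n / (3 * 8 ^ B r) with hq
  have hqpos : 0 < q := Nat.div_pos hfit (by positivity)
  set N : ℕ → ℕ := fun j => q * 8 ^ (B r - B j) with hN
  have hB0 : B 0 = 0 := by simp [hB]
  have hNpos : ∀ j, 0 < N j := fun j => by simp only [hN]; positivity
  have hNB : ∀ j ≤ r, N j * 8 ^ B j = N 0 := by
    intro j hj
    simp only [hN, hB0, mul_assoc, ← pow_add]
    congr 2
    have := hBmono hj
    omega
  have hbge : ∀ j, 16 * ((j + 1) * (j + 2)) ≤ b j := fun j => Nat.le_add_right _ _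
  have hbge' : ∀ j, ℓ j / 18 ≤ b j := by
    intro j
    have h1 := Nat.lt_floor_add_one (ℓ j / 18)
    have h2 : (1 : ℝ) ≤ 16 * (((j : ℝ) + 1) * (j + 2)) := by
      have : (0 : ℝ) ≤ j := Nat.cast_nonneg j
      nlinarith
    simp only [hbdef, blockExponent]
    push_cast
    linarith
  have hN0le : 3 * N 0 ≤ n := by
    have := Nat.div_mul_le_self n (3 * 8 ^ B r)
    simp only [hN, hB0, Nat.sub_zero, hq]
    linarith
  have hN0ge : (n : ℝ) ≤ 6 * N 0 := by
    have h1 := Nat.lt_mul_div_succ n (show 0 < 3 * 8 ^ B r by positivity)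
    rw [← hq] at h1
    have h2 : n ≤ 6 * N 0 := by
      simp only [hN, hB0, Nat.sub_zero]
      have : 8 ^ B r ≤ q * 8 ^ B r := Nat.le_mul_of_pos_left _ hqpos
      nlinarith
    exact_mod_cast h2
  have hCN : ∀ j ≤ r, (C : ℝ) / N j ≤ 12 * c * ℓ 0 * 8 ^ B j := by
    intro j hj
    have hp : (0 : ℝ) < N j := by exact_mod_cast hNpos j
    rw [div_le_iff₀ hp]
    have h1 : (N j : ℝ) * 8 ^ B j = N 0 := by exact_mod_cast hNB j hj
    have h2 : 12 * c * ℓ 0 * 8 ^ B j * N j = 12 * c * ℓ 0 * N 0 := by rw [← h1]; ring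
    rw [h2]
    have h3 : 0 ≤ c * ℓ 0 := by positivity
    nlinarith [mul_le_mul_of_nonneg_left hN0ge h3]
  -- Here `27648 = 96 * 16 * 18`, collected in the last estimate of `hterm`, is below `2 ^ 15`.
  have hcK : 27648 * c * (2 : ℝ) ^ (K : ℝ) ≤ 1 := by
    rw [hcdef, mul_assoc, ← Real.rpow_add (by norm_num)]
    have h1 : (2 : ℝ) ^ (-(8 * K + 15) + K : ℝ) ≤ (2 : ℝ) ^ (-15 : ℝ) :=
      Real.rpow_le_rpow_of_exponent_le (by norm_num) (by
        have : (0 : ℝ) ≤ K := Nat.cast_nonneg K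
        linarith)
    have h2 : (2 : ℝ) ^ (-15 : ℝ) = 1 / 32768 := by
      rw [Real.rpow_neg (by norm_num), show (15 : ℝ) = ((15 : ℕ) : ℝ) by norm_num,
        Real.rpow_natCast]
      norm_num
    rw [h2] at h1
    linarith
  have hterm : ∀ j < r, (C : ℝ) / N j ≤ 1 / 16 / (((j : ℝ) + 1) * (j + 2)) * b j := by
    intro j hj
    have hpp : (0 : ℝ) < ((j : ℝ) + 1) * (j + 2) := by positivity
    refine (hCN j hj.le).trans ?_
    refine le_trans ?_ (mul_le_mul_of_nonneg_left (hbge' j) (by positivity))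
    have h4j : ((j : ℝ) + 1) * (j + 2) ≤ 2 * 4 ^ j := by
      clear * -
      induction j with
      | zero => norm_num
      | succ j ih =>
        push_cast
        rw [pow_succ]
        have : (0 : ℝ) ≤ j := Nat.cast_nonneg j
        nlinarith
    suffices h : 12 * c * ℓ 0 * 8 ^ B j * (2 * 4 ^ j) ≤ 1 / 16 * (ℓ j / 18) by
      rw [div_mul_eq_mul_div, le_div_iff₀ hpp]
      refine le_trans (mul_le_mul_of_nonneg_left h4j (by positivity)) h
    rcases j with _ | j
    · rw [hB0]
      have : (1 : ℝ) ≤ (2 : ℝ) ^ (K : ℝ) := Real.one_le_rpow (by norm_num) (Nat.cast_nonneg K)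
      have h1 : 27648 * c ≤ 1 := by nlinarith
      simp only [pow_zero]
      nlinarith
    · have h1 := eight_pow_sum_blockExponent_le h0 hs (show j < r by omega)
      change (8 : ℝ) ^ B (j + 1) ≤ _ at h1
      have h2 := hK (j + 1)
      have h3 := pow_le_tower h0 hs j (by omega)
      have h4 := tower_zero_le h0 hs j (by omega)
      have h5 : ℓ j ≤ 4 * (2 : ℝ) ^ (ℓ j / 4) := by
        have := three_halves_mul_le_two_rpow (x := ℓ j / 4) (by linarith)
        linarith
      have h6 : (4 : ℝ) ^ (j + 1) = (2 : ℝ) ^ (2 * ((j : ℝ) + 1)) := by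
        rw [show (4 : ℝ) = (2 : ℝ) ^ (2 : ℝ) by norm_num, ← Real.rpow_mul_natCast (by norm_num)]
        push_cast; rfl
      have h7 : (2 : ℝ) ^ (ℓ j / 4) * (2 : ℝ) ^ (48 * ((j : ℝ) + 2) ^ 3 + ℓ j / 2)
          * (2 : ℝ) ^ (2 * ((j : ℝ) + 1)) ≤ (2 : ℝ) ^ (K : ℝ) * (2 : ℝ) ^ ℓ j := by
        rw [← Real.rpow_add (by norm_num), ← Real.rpow_add (by norm_num),
          ← Real.rpow_add (by norm_num)]
        refine Real.rpow_le_rpow_of_exponent_le (by norm_num) ?_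
        push_cast at h2
        rw [pow_succ (3 / 2 : ℝ), show (j : ℝ) + 1 + 1 = j + 2 by ring] at h2
        have h8 : (0 : ℝ) ≤ (3 / 2 : ℝ) ^ j := by positivity
        linarith
      rw [hs j (by omega), h6]
      calc 12 * c * ℓ 0 * 8 ^ B (j + 1) * (2 * (2 : ℝ) ^ (2 * ((j : ℝ) + 1)))
          ≤ 12 * c * (4 * (2 : ℝ) ^ (ℓ j / 4)) * (2 : ℝ) ^ (48 * ((j : ℝ) + 2) ^ 3 + ℓ j / 2)
            * (2 * (2 : ℝ) ^ (2 * ((j : ℝ) + 1))) := by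
            gcongr
            exact h4.trans h5
        _ = 96 * c * ((2 : ℝ) ^ (ℓ j / 4) * (2 : ℝ) ^ (48 * ((j : ℝ) + 2) ^ 3 + ℓ j / 2)
            * (2 : ℝ) ^ (2 * ((j : ℝ) + 1))) := by ring
        _ ≤ 96 * c * ((2 : ℝ) ^ (K : ℝ) * (2 : ℝ) ^ ℓ j) := by gcongr
        _ = 27648 * c * (2 : ℝ) ^ (K : ℝ) * (1 / 16 * ((2 : ℝ) ^ ℓ j / 18)) := by ring
        _ ≤ 1 * (1 / 16 * ((2 : ℝ) ^ ℓ j / 18)) := by gcongr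
        _ = _ := one_mul _
  have hbpos : ∀ j, 0 < b j := fun j => lt_of_lt_of_le (by positivity) (hbge j)
  refine ⟨N, b, fun j _ => hbpos j, fun j _ => hNpos j, fun j hj => ?_, hN0le, ?_⟩
  · simp only [hN, mul_assoc, ← pow_add]
    congr 2
    have h1 := hBmono (show j + 1 ≤ r from hj)
    have h2 := hBsucc j
    omega
  -- The quadratic part of `b j` makes the costs telescope, to a total below 3/16.
  · have hle : ∀ j ∈ range r, ((C : ℝ) / N j + 2) / b j
        ≤ 3 / 16 * (1 / ((j : ℝ) + 1) - 1 / ((j + 1 : ℕ) + 1)) := by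
      intro j hj
      have hb1 : (0 : ℝ) < b j := by exact_mod_cast hbpos j
      have hb2 : 16 * (((j : ℝ) + 1) * (j + 2)) ≤ b j := by exact_mod_cast hbge j
      have h1 := hterm j (Finset.mem_range.mp hj)
      have hpp : (0 : ℝ) < ((j : ℝ) + 1) * (j + 2) := by positivity
      have h2 : (2 : ℝ) ≤ 2 / 16 / (((j : ℝ) + 1) * (j + 2)) * b j := by
        rw [div_mul_eq_mul_div, le_div_iff₀ hpp]
        linarith
      have h3 : 3 / 16 * (1 / ((j : ℝ) + 1) - 1 / ((j + 1 : ℕ) + 1))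
          = 1 / 16 / (((j : ℝ) + 1) * (j + 2)) + 2 / 16 / (((j : ℝ) + 1) * (j + 2)) := by
        push_cast
        rw [show (j : ℝ) + 1 + 1 = j + 2 by ring]
        field_simp
        ring
      rw [h3, div_le_iff₀ hb1, add_mul]
      exact add_le_add h1 h2
    refine (Finset.sum_le_sum hle).trans_lt ?_
    rw [← Finset.mul_sum, Finset.sum_range_sub' (fun j : ℕ => 1 / ((j : ℝ) + 1))]
    have : (0 : ℝ) ≤ 1 / ((r : ℝ) + 1) := by positivity
    have h1 : 1 / (((0 : ℕ) : ℝ) + 1) = 1 := by norm_num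
    rw [h1]
    linarith

/-! ### The lower bound -/

theorem mainTheorem1 :
    ∃ c : ℝ, 0 < c ∧ ∀ n : ℕ, 1 ≤ n → ∀ r : ℕ, r ≤ logStar n →
      ∀ (Ω : Type*) [MeasurableSpace Ω] (μ : Measure Ω) [IsProbabilityMeasure μ]
        (P : RandProtocol Ω (Fin n → Fin (4 * n)) r),
        P.error μ (existsEqual n (4 * n)) ≤ 1 / 3 →
          P.SendsMessageOfSize μ (c * (n * iterLog r n)) := by
  obtain ⟨K, hK⟩ := exists_nat_cubic_le_add_pow
  refine ⟨(2 : ℝ) ^ (-(8 * K + 15) : ℝ), by positivity, ?_⟩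
  intro n hn r hr Ω _ μ _ P herr
  by_contra hL
  set c : ℝ := (2 : ℝ) ^ (-(8 * K + 15) : ℝ) with hc
  have hn' : (1 : ℝ) ≤ n := by exact_mod_cast hn
  have : Nonempty (Fin (4 * n)) := ⟨⟨0, by omega⟩⟩
  -- Here only empty messages can occur, and a single coordinate suffices: `1 ≤ 2 / 3 + 1 / 4` is
  -- false.
  by_cases htriv : r = 0 ∨ c * (n * iterLog r n) ≤ 1
  · obtain ⟨D, hD, hle⟩ := exists_detProtocol_labelError_le hn hn one_pos μ P herr _ hL
    have hshort : D.IsShort 1 := by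
      rcases htriv with h | h
      · subst h; exact D.isShort_one_of_zero
      · intro a b l hl
        exact_mod_cast (hD a b l hl).trans_le h
    rw [D.labelError_eq_one_of_isShort_one hshort] at hle
    have : ((1 : ℕ) : ℝ) / (4 * n) ≤ 1 / 4 := by
      rw [Nat.cast_one]
      exact one_div_le_one_div_of_le (by norm_num) (by linarith)
    linarith
  · rw [not_or, not_le] at htriv
    obtain ⟨hr0, hbig⟩ := htriv
    have htwo : ∀ k < r, 2 ≤ iterLog k n := fun k hk => by
      have := Nat.notMem_of_lt_sInf (hk.trans_le hr)
      simpa using this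
    -- Reversing the iterated logarithms gives a tower from `log^(r) n` up to `n`; minimality in
    -- `logStar` makes its base at least 1.
    set ℓ : ℕ → ℝ := fun j => iterLog (r - j) n with hℓ
    have hstep : ∀ j < r, ℓ (j + 1) = (2 : ℝ) ^ ℓ j := by
      intro j hj
      have h1 := htwo (r - (j + 1)) (by omega)
      simp only [hℓ]
      rw [show r - j = r - (j + 1) + 1 by omega, iterLog,
        Real.rpow_logb (by norm_num) (by norm_num) (by linarith)]
    have h0 : 1 ≤ ℓ 0 := by
      have h1 := htwo (r - 1) (by omega)
      simp only [hℓ]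
      rw [show r - 0 = r - 1 + 1 by omega, iterLog,
        Real.le_logb_iff_rpow_le (by norm_num) (by linarith)]
      simpa using h1
    have hlast : ℓ r = n := by simp [hℓ, iterLog]
    have hceil := Nat.ceil_lt_add_one (show 0 ≤ c * (n * iterLog r n) by linarith)
    obtain ⟨N, b, hb, hN, hNb, hN0, hsum⟩ := exists_blocks hK
      (C := ⌈c * (n * iterLog r n)⌉₊) (Nat.pos_of_ne_zero hr0) h0 hstep hlast hc
      hbig (by simp only [hℓ, Nat.sub_zero]; linarith)
    obtain ⟨D, hD, hle⟩ := exists_detProtocol_labelError_le hn (show N 0 ≤ n by omega)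
      (hN 0 (Nat.zero_le _)) μ P herr _ hL
    have hshort : D.IsShort ⌈c * (n * iterLog r n)⌉₊ := fun a b l hl =>
      Nat.lt_ceil.mpr (hD a b l hl)
    have h1 := one_le_labelError_add_sum r _ N b hb hN hNb _ _ (Fintype.card_fin _) D hshort
    have h2 : (N 0 : ℝ) / (4 * n) ≤ 1 / 12 := by
      rw [div_le_iff₀ (by linarith)]
      have : (3 : ℝ) * N 0 ≤ n := by exact_mod_cast hN0
      linarith
    -- The contradiction is `1 < 2 / 3 + 1 / 12 + 1 / 4 = 1`.
    linarith
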